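/- Let $G$ be a finite connected undirected graph with vertex set $V\neq\emptyset$, a finite set $E_b$ of bulk edges (each having two ends in $V$; loops and parallel edges are allowed) and a finite non-empty set $E_\partial$ of half-edges, each attached to a vertex (several half-edges may be attached to the same vertex). Let $E_\partial=A\sqcup B$. Random tensor. For $D\in\mathbb N$ attach a copy of $\mathbb C^D$ to each half-edge and to each of the two ends of every bulk edge; for $x\in V$ let $\mathcal H_x$ be the tensor product of the spaces attached to the half-edges and edge ends at $x$. Let $g_x\in\mathcal H_x$ ($x\in V$) be independent random vectors whose coordinates in the standard basis are i.i.d. standard complex Gaussian variables (independent real and imaginary parts $\sim N(0,\tfrac12)$). With $\Omega_e=D^{-1/2}\sum_{i=1}^D|i,i\rangle$ on the two ends of $e\in E_b$, put $$|\psi_G\rangle:=\Big\langle\bigotimes_{e\in E_b}\Omega_e\;\Big|\;\bigotimes_{x\in V}g_x\Big\rangle\in(\mathbb C^D)^{\otimes|E_\partial|},\qquad \rho_A:=\operatorname{Tr}_B|\psi_G\rangle\langle\psi_G| .$$ Network. Let $G_{A|B}$ be the graph obtained from $G$ by adding two vertices, a source $\mathrm{id}$ and a sink $\gamma$, and by connecting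 every half-edge in $A$ to $\gamma$ and every half-edge in $B$ to $\mathrm{id}$. Let $F=\operatorname{maxflow}(G_{A|B})$ be the maximal number of pairwise edge-disjoint (undirected) paths from $\mathrm{id}$ to $\gamma$ in $G_{A|B}$. Hamiltonian. For $n\ge1$ let $\gamma=(n\;n-1\;\cdots\;2\;1)\in\mathcal S_n$ be the full cycle and let $|\sigma|=n-\#\sigma$, where $\#\sigma$ is the number of cycles of $\sigma\in\mathcal S_n$, fixed points included. For $\alpha=(\alpha_x)_{x\in V}\in\mathcal S_n^{V}$ put $$H^{(n)}_{G_{A|B}}(\alpha)=\sum_{(x,\cdot)\in A}|\gamma^{-1}\alpha_x|+\sum_{(x,\cdot)\in B}|\mathrm{id}^{-1}\alpha_x|+\sum_{(x,y)\in E_b}|\alpha_x^{-1}\alpha_y|,$$ and let $m_n$ be the number of $\alpha\in\mathcal S_n^{V}$ at which $H^{(n)}_{G_{A|B}}$ attains its minimum over $\mathcal S_n^{V}$. Theorem. For every $n\ge1$ the random variable $D^{-F}\operatorname{Tr}\big((D^{F-|E_\partial|}\rho_A)^n\big)$ is integrable for all $D$, and $$\lim_{D\to\infty}\;\mathbb E\,\frac1{D^{F}}\operatorname{Tr}\Big(\big(D^{F-|E_\partial|}\rho_A\big)^n\Big)=m_n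 .$$ Moreover there is a probability measure $\mu_{G_{A|B}}$ on $\mathbb R$, with compact support contained in $[0,\infty)$, such that $\int t^n\,d\mu_{G_{A|B}}(t)=m_n$ for all $n\ge1$. -/

import Mathlib

open MeasureTheory ProbabilityTheory Filter Topology

namespace RTN

/-! ### Finite undirected multigraphs, walks, paths, maximum flow -/

/-- An undirected multigraph with vertices `V` and edges `E`; loops and parallel edges are allowed.
Every edge has two ends, labelled by `Bool`; the labelling carries no orientation: walks may
traverse an edge in both ways. -/
structure Multigraph (V E : Type*) where
  /-- the two end vertices of an edge -/
  ends : E → Bool → V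

namespace Multigraph

variable {V E : Type*}

/-- The edge `e` joins `u` and `v`, in either direction. -/
def Joins (G : Multigraph V E) (e : E) (u v : V) : Prop :=
  (G.ends e false = u ∧ G.ends e true = v) ∨ (G.ends e false = v ∧ G.ends e true = u)

/-- Walks from one vertex to another. -/
inductive Walk (G : Multigraph V E) : V → V → Type _
  | nil (u : V) : Walk G u u
  | cons {u v w : V} (e : E) (h : G.Joins e u v) (p : Walk G v w) : Walk G u w

/-- The edges traversed by a walk, in order. -/
def Walk.edges {G : Multigraph V E} : {u v : V} → G.Walk u v → List E
  | _, _, .nil _ => []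
  | _, _, .cons e _ p => e :: p.edges

/-- The vertices visited by a walk, in order. -/
def Walk.support {G : Multigraph V E} : {u v : V} → G.Walk u v → List V
  | _, _, .nil u => [u]
  | u, _, .cons _ _ p => u :: p.support

/-- A path is a walk which visits no vertex twice. -/
def Path (G : Multigraph V E) (u v : V) : Type _ :=
  {p : G.Walk u v // p.support.Nodup}

/-- A multigraph is connected if it has a vertex and any two vertices are joined by a walk. -/
def Connected (G : Multigraph V E) : Prop :=
  Nonempty V ∧ ∀ u v : V, Nonempty (G.Walk u v)

/-- The numbers `k` for which there are `k` pairwise edge-disjoint paths from `s` to `t`. -/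
def disjointPathCounts (G : Multigraph V E) (s t : V) : Set ℕ :=
  {k | ∃ P : Fin k → G.Path s t, ∀ i j, i ≠ j → List.Disjoint (P i).1.edges (P j).1.edges}

/-- The maximal number of pairwise edge-disjoint paths from `s` to `t`. -/
noncomputable def maxflow (G : Multigraph V E) (s t : V) : ℕ :=
  sSup (G.disjointPathCounts s t)

/-- The supremum in the definition of `maxflow` is a maximum. -/
theorem maxflow_isGreatest [Fintype E] (G : Multigraph V E) {s t : V} (hst : s ≠ t) :
    IsGreatest (G.disjointPathCounts s t) (G.maxflow s t) := by
  have hne : ∀ p : G.Walk s t, ∃ e, e ∈ p.edges := by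
    intro p
    cases p with
    | nil => exact absurd rfl hst
    | cons e h q => exact ⟨e, by simp [Walk.edges]⟩
  have hb : BddAbove (G.disjointPathCounts s t) := by
    refine ⟨Fintype.card E, ?_⟩
    rintro k ⟨P, hP⟩
    choose f hf using fun i => hne (P i).1
    have hinj : Function.Injective f := by
      intro i j hij
      by_contra hne'
      exact hP i j hne' (hf i) (hij ▸ hf j)
    simpa using Fintype.card_le_of_injective f hinj
  have h0 : (G.disjointPathCounts s t).Nonempty := ⟨0, fun i => i.elim0, fun i => i.elim0⟩
  exact ⟨Nat.sSup_mem h0 hb, fun k hk => le_csSup hb hk⟩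

end Multigraph

/-! ### Graphs with half-edges and the network obtained from a boundary region -/

/-- A graph with vertices `V`, (full) bulk edges `Eb` and half-edges (boundary edges) `Eh`. -/
structure OpenGraph (V Eb Eh : Type*) where
  /-- the graph formed by the vertices and the bulk edges -/
  bulk : Multigraph V Eb
  /-- the vertex at which a half-edge is attached -/
  root : Eh → V

/-- Vertices of the network: those of the graph and two further ones, a source (labelled by the
identity permutation) and a sink (labelled by the full cycle). -/
inductive NetVertex (V : Type*)
  | source : NetVertex V
  | sink : NetVertex V
  | vertex (x : V) : NetVertex V

namespace OpenGraph

variable {V Eb Eh : Type*}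

/-- The network `G_{A|B}`, where `B` is the complement of `A`: all half-edges in `A` are connected
to the sink and all half-edges in `B` to the source. -/
def network [DecidableEq Eh] (G : OpenGraph V Eb Eh) (A : Finset Eh) :
    Multigraph (NetVertex V) (Eb ⊕ Eh) where
  ends
    | .inl e => fun b => .vertex (G.bulk.ends e b)
    | .inr h => fun b =>
        match b with
        | false => .vertex (G.root h)
        | true => if h ∈ A then .sink else .source

/-- `maxflow(G_{A|B})`: the maximal number of edge-disjoint paths from source to sink. -/
noncomputable def flow [DecidableEq Eh] (G : OpenGraph V Eb Eh) (A : Finset Eh) : ℕ :=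
  (G.network A).maxflow .source .sink

/-! ### The random tensor -/

/-- The tensor legs of the network: two for each bulk edge, one for each half-edge. -/
abbrev Leg (Eb Eh : Type*) : Type _ := (Eb × Bool) ⊕ Eh

/-- The vertex to which a leg belongs. -/
def legVertex (G : OpenGraph V Eb Eh) : Leg Eb Eh → V
  | .inl (e, b) => G.bulk.ends e b
  | .inr h => G.root h

/-- The legs at the vertex `x`. -/
abbrev LegsAt (G : OpenGraph V Eb Eh) (x : V) : Type _ := {l : Leg Eb Eh // G.legVertex l = x}

/-- A family of vertex tensors `g_x ∈ ⨂_{legs at x} ℂ^D`, given by their coordinates in the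
standard basis. -/
abbrev VertexTensors (G : OpenGraph V Eb Eh) (D : ℕ) : Type _ :=
  (x : V) → (G.LegsAt x → Fin D) → ℂ

end OpenGraph

/-- The standard complex Gaussian law: independent real and imaginary parts, each centred with
variance `1/2`. -/
noncomputable def complexGaussian : Measure ℂ :=
  ((gaussianReal 0 (1 / 2)).prod (gaussianReal 0 (1 / 2))).map
    (fun p : ℝ × ℝ => (p.1 : ℂ) + (p.2 : ℂ) * Complex.I)

/-- The maximally entangled state `D^{-1/2} ∑ᵢ |i,i⟩` of `ℂ^D ⊗ ℂ^D`, in coordinates. -/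
noncomputable def entangled (D : ℕ) (i j : Fin D) : ℂ :=
  if i = j then ((1 / Real.sqrt (D : ℝ) : ℝ) : ℂ) else 0

/-- Partial trace over the tensor factors outside `A`, for a matrix on `⨂_{h ∈ Eh} ℂ^D`. -/
def partialTrace {Eh : Type*} [Fintype Eh] [DecidableEq Eh] (A : Finset Eh) {D : ℕ}
    (M : Matrix (Eh → Fin D) (Eh → Fin D) ℂ) :
    Matrix ({h // h ∈ A} → Fin D) ({h // h ∈ A} → Fin D) ℂ :=
  fun i i' => ∑ b : {h // h ∉ A} → Fin D,
    M (fun h => if hA : h ∈ A then i ⟨h, hA⟩ else b ⟨h, hA⟩)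
      (fun h => if hA : h ∈ A then i' ⟨h, hA⟩ else b ⟨h, hA⟩)

namespace OpenGraph

variable {V Eb Eh : Type*} [Fintype V] [DecidableEq V] [Fintype Eb] [DecidableEq Eb]
  [Fintype Eh] [DecidableEq Eh]

/-- The law of the vertex tensors: all coordinates of all of them are independent standard complex
Gaussian variables. -/
noncomputable def gaussianLaw (G : OpenGraph V Eb Eh) (D : ℕ) : Measure (G.VertexTensors D) :=
  Measure.pi fun x => Measure.pi fun _ : G.LegsAt x → Fin D => complexGaussian

/-- The tensor `ψ_G = ⟨⨂_{e ∈ Eb} Ω_e | ⨂_{x ∈ V} g_x⟩ ∈ ⨂_{h ∈ Eh} ℂ^D`. The sum runs over the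
basis labels `j` of the legs of the bulk edges, `i` being the labels of the half-edges. -/
noncomputable def tensor (G : OpenGraph V Eb Eh) {D : ℕ} (g : G.VertexTensors D)
    (i : Eh → Fin D) : ℂ :=
  ∑ j : Eb × Bool → Fin D,
    star (∏ e : Eb, entangled D (j (e, false)) (j (e, true))) *
      ∏ x : V, g x fun l => Sum.elim j i l.1

/-- The unnormalised reduced density matrix `ρ_A = Tr_B |ψ_G⟩⟨ψ_G|`. -/
noncomputable def reducedDensity (G : OpenGraph V Eb Eh) (A : Finset Eh) {D : ℕ}
    (g : G.VertexTensors D) : Matrix ({h // h ∈ A} → Fin D) ({h // h ∈ A} → Fin D) ℂ :=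
  partialTrace A (Matrix.vecMulVec (G.tensor g) (star (G.tensor g)))

/-- `D^{-F} Tr ((D^{F - |E_∂|} ρ_A)^n)`, where `F` is the maximal flow. -/
noncomputable def scaledTrace (G : OpenGraph V Eb Eh) (A : Finset Eh) (n D : ℕ)
    (g : G.VertexTensors D) : ℂ :=
  1 / (D : ℂ) ^ G.flow A *
    Matrix.trace
      (((D : ℂ) ^ ((G.flow A : ℤ) - (Fintype.card Eh : ℤ)) • G.reducedDensity A g) ^ n)

end OpenGraph

/-! ### The Hamiltonian -/

/-- The number of cycles of a permutation, fixed points included. -/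
noncomputable def numCycles {n : ℕ} (σ : Equiv.Perm (Fin n)) : ℕ :=
  Nat.card (Quotient (Equiv.Perm.SameCycle.setoid σ))

/-- The Cayley length `|σ| = n - #σ`; the subtraction does not truncate as `#σ ≤ n`. -/
noncomputable def cayleyLength {n : ℕ} (σ : Equiv.Perm (Fin n)) : ℕ :=
  n - numCycles σ

/-- The full cycle `γ = (n n-1 ⋯ 2 1)`. -/
def fullCycle (n : ℕ) : Equiv.Perm (Fin n) := (finRotate n)⁻¹

namespace OpenGraph

variable {V Eb Eh : Type*} [Fintype Eb] [Fintype Eh] [DecidableEq Eh]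

/-- The Hamiltonian of the network `G_{A|B}` at the spin configuration `α`. -/
noncomputable def hamiltonian (G : OpenGraph V Eb Eh) (A : Finset Eh) (n : ℕ)
    (α : V → Equiv.Perm (Fin n)) : ℕ :=
  ∑ h ∈ A, cayleyLength ((fullCycle n)⁻¹ * α (G.root h)) +
    ∑ h ∈ Aᶜ, cayleyLength (1⁻¹ * α (G.root h)) +
    ∑ e : Eb, cayleyLength ((α (G.bulk.ends e false))⁻¹ * α (G.bulk.ends e true))

/-- The number of spin configurations at which the Hamiltonian attains its minimum. -/
noncomputable def numMinimizers (G : OpenGraph V Eb Eh) (A : Finset Eh) (n : ℕ) : ℕ :=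
  Nat.card {α : V → Equiv.Perm (Fin n) // ∀ β, G.hamiltonian A n α ≤ G.hamiltonian A n β}

end OpenGraph

end RTN

/-!
Gaussian integration turns the moments of `ρ_A` into a spin model, and the rescaling keeps only its
ground states. Expand `Tr ρ_A ^ n` in the coordinates of the vertex tensors, `n` copies of each and
of its conjugate. Wick's formula at every vertex produces a sum over `α : V → Perm (Fin n)`, and
the sum over the labels of an edge gives one factor `D` for each cycle of the relative permutation
along that edge. Hence `𝔼 Tr ρ_A ^ n = ∑ α, D ^ (n |E_∂| - H α)`
(`integral_trace_reducedDensity_pow`), and in the rescaled moment `α` has weight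
`D ^ (F (n - 1) - H α)`. The Cayley length is a metric for which the full cycle has distance `n - 1`
from the identity; so each of `F` edge-disjoint paths from source to sink costs at least `n - 1`,
while a single domain wall along a minimal cut costs `F (n - 1)` by max-flow min-cut
(`Multigraph.exists_cut_le_maxflow`). Therefore `min H = F (n - 1)`, and the limit counts
minimizers.

The measure is obtained from a moment problem. A minimal cut bounds the rank of `ρ_A` by `D ^ F`
(`rank_reducedDensity_le`), so that normalizing by `D ^ F` and setting the zeroth moment to one
amounts to dropping superfluous zero eigenvalues of a positive semidefinite matrix. In the limit,
the sequence `1, m₁, m₂, …` defines a functional which is nonnegative on the polynomials that are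
nonnegative on `[0, ∞)`. Moreover `m_n ≤ (4 ^ |V|) ^ n`: in a minimizer every spin lies on a
geodesic from the identity to the full cycle, because the graph is connected, and the number of such
permutations is at most the Catalan number (`card_onGeodesic_prod_le`). Exponential growth improves
positivity on `[0, ∞)` to positivity on a compact interval
(`momentFunctional_nonneg_of_nonneg_Icc`), and the theorems of M. Riesz and
Riesz–Markov–Kakutani supply the measure.

Cayley lengths are handled by linear algebra: the number of cycles of `σ` is the dimension of the
space of functions invariant under `σ`, and subadditivity is the dimension formula for the
intersection of two such spaces.
-/

namespace RTN

/-! ### Cayley length via invariant functions -/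

/-- The functions on `Fin n` which are constant on the cycles of `σ`. Their dimension is the number
of cycles, which turns inequalities between Cayley lengths into dimension counts. -/
def invariantFunctions {n : ℕ} (σ : Equiv.Perm (Fin n)) : Submodule ℚ (Fin n → ℚ) where
  carrier := {f | ∀ i, f (σ i) = f i}
  add_mem' hf hg i := by simp [hf i, hg i]
  zero_mem' _ := rfl
  smul_mem' c f hf i := by simp [hf i]

section CayleyLength

variable {n : ℕ}

theorem mem_invariantFunctions {σ : Equiv.Perm (Fin n)} {f : Fin n → ℚ} :
    f ∈ invariantFunctions σ ↔ ∀ i, f (σ i) = f i := Iff.rfl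

theorem apply_eq_of_sameCycle {β : Type*} {σ : Equiv.Perm (Fin n)} {f : Fin n → β}
    (hf : ∀ i, f (σ i) = f i) {i j : Fin n} (h : σ.SameCycle i j) : f i = f j := by
  obtain ⟨k, -, rfl⟩ := h.exists_pow_eq'
  have : ∀ k : ℕ, f ((σ ^ k) i) = f i := by
    intro k
    induction k with
    | zero => simp
    | succ k ih => rw [pow_succ', Equiv.Perm.mul_apply, hf, ih]
  exact (this k).symm

/-- Functions invariant under `σ` are the same as functions on the set of cycles of `σ`. -/
noncomputable def invariantEquiv (β : Type*) (σ : Equiv.Perm (Fin n)) :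
    {f : Fin n → β // ∀ i, f (σ i) = f i} ≃
      (Quotient (Equiv.Perm.SameCycle.setoid σ) → β) where
  toFun f q := Quotient.lift (s := Equiv.Perm.SameCycle.setoid σ) f.1
    (fun _ _ h => apply_eq_of_sameCycle f.2 h) q
  invFun g := ⟨fun i => g (Quotient.mk _ i), fun i => congrArg g (Quotient.sound
    (Equiv.Perm.sameCycle_apply_left.2 (Equiv.Perm.SameCycle.refl _ _)))⟩
  left_inv f := rfl
  right_inv g := by
    funext q
    induction q using Quotient.inductionOn
    rfl

theorem card_invariant (D : ℕ) (σ : Equiv.Perm (Fin n)) :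
    Nat.card {f : Fin n → Fin D // ∀ i, f (σ i) = f i} = D ^ numCycles σ := by
  rw [Nat.card_congr (invariantEquiv (Fin D) σ), Nat.card_fun, Nat.card_fin, numCycles]

theorem finrank_invariantFunctions (σ : Equiv.Perm (Fin n)) :
    Module.finrank ℚ (invariantFunctions σ) = numCycles σ := by
  classical
  have : Fintype (Quotient (Equiv.Perm.SameCycle.setoid σ)) := Fintype.ofFinite _
  let e : invariantFunctions σ ≃ₗ[ℚ] (Quotient (Equiv.Perm.SameCycle.setoid σ) → ℚ) :=
    { invariantEquiv ℚ σ with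
      map_add' := by
        intro f g
        funext q
        induction q using Quotient.inductionOn
        rfl
      map_smul' := by
        intro c f
        funext q
        induction q using Quotient.inductionOn
        rfl }
  rw [e.finrank_eq, Module.finrank_pi, numCycles, Nat.card_eq_fintype_card]

theorem numCycles_le (σ : Equiv.Perm (Fin n)) : numCycles σ ≤ n := by
  rw [← finrank_invariantFunctions]
  simpa using Submodule.finrank_le (invariantFunctions σ)

theorem cayleyLength_add_numCycles (σ : Equiv.Perm (Fin n)) :
    cayleyLength σ + numCycles σ = n := Nat.sub_add_cancel (numCycles_le σ)

theorem invariantFunctions_inf_le (σ τ : Equiv.Perm (Fin n)) :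
    invariantFunctions σ ⊓ invariantFunctions τ ≤ invariantFunctions (σ * τ) := by
  rintro f ⟨h1, h2⟩ i
  rw [Equiv.Perm.mul_apply, h1, h2]

theorem numCycles_add_le (σ τ : Equiv.Perm (Fin n)) :
    numCycles σ + numCycles τ ≤
      Module.finrank ℚ ↥(invariantFunctions σ ⊓ invariantFunctions τ) + n := by
  have h := Submodule.finrank_sup_add_finrank_inf_eq (invariantFunctions σ) (invariantFunctions τ)
  have h2 := Submodule.finrank_le (invariantFunctions σ ⊔ invariantFunctions τ)
  simp only [finrank_invariantFunctions, Module.finrank_fintype_fun_eq_card, Fintype.card_fin]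
    at h h2
  omega

theorem cayleyLength_mul_le (σ τ : Equiv.Perm (Fin n)) :
    cayleyLength (σ * τ) ≤ cayleyLength σ + cayleyLength τ := by
  have h := numCycles_add_le σ τ
  have h2 := Submodule.finrank_mono (invariantFunctions_inf_le σ τ)
  rw [finrank_invariantFunctions] at h2
  have := cayleyLength_add_numCycles σ
  have := cayleyLength_add_numCycles τ
  have := cayleyLength_add_numCycles (σ * τ)
  omega

/-- If Cayley lengths add up in the product `σ * τ`, then every cycle of `σ` is contained in a cycle
of `σ * τ`. -/
theorem invariantFunctions_le_of_cayleyLength_add {σ τ : Equiv.Perm (Fin n)}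
    (h : cayleyLength σ + cayleyLength τ = cayleyLength (σ * τ)) :
    invariantFunctions (σ * τ) ≤ invariantFunctions σ := by
  have h1 := numCycles_add_le σ τ
  have := cayleyLength_add_numCycles σ
  have := cayleyLength_add_numCycles τ
  have := cayleyLength_add_numCycles (σ * τ)
  have h3 := Submodule.eq_of_le_of_finrank_le (invariantFunctions_inf_le σ τ)
    (by rw [finrank_invariantFunctions]; omega)
  rw [← h3]
  exact inf_le_left

theorem invariantFunctions_inv (σ : Equiv.Perm (Fin n)) :
    invariantFunctions σ⁻¹ = invariantFunctions σ := by
  ext f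
  constructor
  · intro h i
    have := h (σ i)
    simpa using this.symm
  · intro h i
    have := h (σ⁻¹ i)
    simpa using this.symm

theorem cayleyLength_inv (σ : Equiv.Perm (Fin n)) : cayleyLength σ⁻¹ = cayleyLength σ := by
  rw [cayleyLength, cayleyLength, ← finrank_invariantFunctions, ← finrank_invariantFunctions,
    invariantFunctions_inv]

theorem cayleyLength_one : cayleyLength (1 : Equiv.Perm (Fin n)) = 0 := by
  have h := cayleyLength_add_numCycles (1 : Equiv.Perm (Fin n))
  have : invariantFunctions (1 : Equiv.Perm (Fin n)) = ⊤ := by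
    ext f; simp [mem_invariantFunctions]
  rw [← finrank_invariantFunctions, this, finrank_top] at h
  simp at h
  omega

theorem eq_one_of_cayleyLength {σ : Equiv.Perm (Fin n)} (h : cayleyLength σ = 0) : σ = 1 := by
  have h1 := cayleyLength_add_numCycles σ
  have h2 : invariantFunctions σ = ⊤ := by
    apply Submodule.eq_top_of_finrank_eq
    rw [finrank_invariantFunctions]
    simp
    omega
  ext i
  have h3 : Pi.single i (1 : ℚ) ∈ invariantFunctions σ := h2 ▸ Submodule.mem_top
  have h4 := h3 i
  rw [Pi.single_eq_same] at h4
  by_contra hne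
  rw [Pi.single_eq_of_ne (by simpa [Fin.ext_iff] using hne)] at h4
  exact zero_ne_one h4

theorem cayleyLength_swap_le (x y : Fin n) : cayleyLength (Equiv.swap x y) ≤ 1 := by
  have h := cayleyLength_add_numCycles (Equiv.swap x y)
  rw [← finrank_invariantFunctions] at h
  let φ : (Fin n → ℚ) →ₗ[ℚ] ℚ := LinearMap.proj (R := ℚ) (φ := fun _ : Fin n => ℚ) x -
    LinearMap.proj (R := ℚ) (φ := fun _ : Fin n => ℚ) y
  have hle : LinearMap.ker φ ≤ invariantFunctions (Equiv.swap x y) := by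
    intro f hf i
    have hf' : f x = f y := by simpa [φ, sub_eq_zero] using hf
    rw [Equiv.swap_apply_def]
    split_ifs with h1 h2
    · rw [h1, hf']
    · rw [h2, hf']
    · rfl
  have h1 := Submodule.finrank_mono hle
  have h2 := φ.finrank_range_add_finrank_ker
  have h3 := Submodule.finrank_le (LinearMap.range φ)
  simp at h2 h3
  omega

/-- Inserting a fixed point `x` of `β` into the cycle of `y` lengthens `β` by one. -/
theorem cayleyLength_swap_mul {β : Equiv.Perm (Fin n)} {x y : Fin n} (hx : β x = x) (hxy : x ≠ y) :
    cayleyLength (Equiv.swap x y * β) = cayleyLength β + 1 := by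
  have h1 := (cayleyLength_mul_le (Equiv.swap x y) β).trans
    (Nat.add_le_add_right (cayleyLength_swap_le x y) _)
  have hlt : invariantFunctions (Equiv.swap x y * β) < invariantFunctions β := by
    refine lt_of_le_of_ne ?_ ?_
    · intro f hf i
      have hyx : f y = f x := by simpa [hx] using hf x
      have := hf i
      rw [Equiv.Perm.mul_apply, Equiv.swap_apply_def] at this
      split_ifs at this with h1 h2
      · rw [h1, ← hyx, this]
      · rw [h2, hyx, this]
      · exact this
    · intro heq
      have hmem : (Pi.single x (1 : ℚ) : Fin n → ℚ) ∈ invariantFunctions β := by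
        intro i
        by_cases hi : i = x
        · rw [hi, hx]
        · have : β i ≠ x := fun h => hi (β.injective (h.trans hx.symm))
          rw [Pi.single_eq_of_ne this, Pi.single_eq_of_ne hi]
      rw [← heq] at hmem
      have := hmem x
      simp [hx, Pi.single_eq_of_ne hxy.symm] at this
  have h2 := Submodule.finrank_lt_finrank_of_lt hlt
  rw [finrank_invariantFunctions, finrank_invariantFunctions] at h2
  have := cayleyLength_add_numCycles β
  have := cayleyLength_add_numCycles (Equiv.swap x y * β)
  omega

theorem cayleyLength_fullCycle (hn : 1 ≤ n) : cayleyLength (fullCycle n) = n - 1 := by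
  rw [fullCycle, cayleyLength_inv, cayleyLength, numCycles]
  congr 1
  obtain ⟨m, rfl⟩ : ∃ m, n = m + 1 := ⟨n - 1, by omega⟩
  rw [Nat.card_eq_one_iff_unique]
  have h0 : ∀ k : ℕ, ∀ hk : k < m + 1, (finRotate (m + 1)).SameCycle 0 ⟨k, hk⟩ := by
    intro k
    induction k with
    | zero => intro _; exact Equiv.Perm.SameCycle.refl _ _
    | succ k ih =>
      intro hk
      have h := ih (by omega)
      have h2 : finRotate (m + 1) ⟨k, by omega⟩ = ⟨k + 1, hk⟩ :=
        finRotate_of_lt (by omega)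
      rw [← h2]
      exact Equiv.Perm.sameCycle_apply_right.2 h
  refine ⟨⟨fun a b => ?_⟩, ⟨Quotient.mk _ 0⟩⟩
  induction a using Quotient.inductionOn with | _ a
  induction b using Quotient.inductionOn with | _ b
  exact Quotient.sound ((h0 a a.2).symm.trans (h0 b b.2))

/-! ### Counting permutations on a geodesic -/

/-- `β` lies on a geodesic of the Cayley graph from the identity to `σ`. -/
def OnGeodesic (β σ : Equiv.Perm (Fin n)) : Prop :=
  cayleyLength β + cayleyLength (β⁻¹ * σ) = cayleyLength σ

theorem OnGeodesic.invariantFunctions_le {β σ : Equiv.Perm (Fin n)} (h : OnGeodesic β σ) :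
    invariantFunctions σ ≤ invariantFunctions β := by
  have := invariantFunctions_le_of_cayleyLength_add (σ := β) (τ := β⁻¹ * σ)
    (by rw [mul_inv_cancel_left]; exact h)
  rwa [mul_inv_cancel_left] at this

theorem onGeodesic_one {β : Equiv.Perm (Fin n)} (h : OnGeodesic β 1) : β = 1 := by
  apply eq_one_of_cayleyLength
  rw [OnGeodesic, cayleyLength_one] at h
  omega

/-- A point `x` fixed by `β` may be deleted from the cycle `x :: l` of the end point of the
geodesic. -/
theorem OnGeodesic.remove_fixed {β ρ : Equiv.Perm (Fin n)} {x : Fin n} {l : List (Fin n)}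
    (hx : x ∉ l) (hβ : β x = x) (hρ : ρ x = x)
    (h : OnGeodesic β ((x :: l).formPerm * ρ)) : OnGeodesic β (l.formPerm * ρ) := by
  cases l with
  | nil => simpa using h
  | cons y l =>
    rw [List.formPerm_cons_cons, mul_assoc] at h
    set σ := (y :: l).formPerm * ρ with hσ
    have hσx : σ x = x := by
      rw [hσ, Equiv.Perm.mul_apply, hρ, List.formPerm_apply_of_notMem hx]
    have hxy : x ≠ y := fun h => hx (by simp [h])
    have hβ' : β⁻¹ x = x := by rw [Equiv.Perm.inv_eq_iff_eq, hβ]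
    have h1 := cayleyLength_swap_mul hσx hxy
    have h2 : β⁻¹ * (Equiv.swap x y * σ) = Equiv.swap x (β⁻¹ y) * (β⁻¹ * σ) := by
      rw [← mul_assoc, Equiv.mul_swap_eq_swap_mul, hβ', mul_assoc]
    have h3 : cayleyLength (Equiv.swap x (β⁻¹ y) * (β⁻¹ * σ)) = cayleyLength (β⁻¹ * σ) + 1 := by
      apply cayleyLength_swap_mul
      · rw [Equiv.Perm.mul_apply, hσx, hβ']
      · intro h
        apply hxy
        have := congrArg β h
        rw [hβ] at this
        simpa using this
    rw [OnGeodesic, h2, h3, h1] at h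
    rw [OnGeodesic]
    omega

/-- Multiplying with the transposition of `x` and `β x` makes `x` a fixed point. -/
theorem OnGeodesic.swap_mul {β σ : Equiv.Perm (Fin n)} {x i : Fin n} (hi : β x = i) (hix : x ≠ i)
    (h : OnGeodesic β σ) : OnGeodesic (Equiv.swap x i * β) (Equiv.swap x i * σ) := by
  have h1 : cayleyLength β = cayleyLength (Equiv.swap x i * β) + 1 := by
    rw [← cayleyLength_swap_mul (β := Equiv.swap x i * β) (x := x) (y := i) (by simp [hi]) hix,
      Equiv.swap_mul_self_mul]
  have h2 : (Equiv.swap x i * β)⁻¹ * (Equiv.swap x i * σ) = β⁻¹ * σ := by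
    group
  have h3 := cayleyLength_mul_le (Equiv.swap x i) (Equiv.swap x i * σ)
  rw [Equiv.swap_mul_self_mul] at h3
  have h4 := cayleyLength_swap_le x i
  have h5 := cayleyLength_mul_le (Equiv.swap x i * β)
    ((Equiv.swap x i * β)⁻¹ * (Equiv.swap x i * σ))
  rw [mul_inv_cancel_left, h2] at h5
  rw [OnGeodesic] at h ⊢
  rw [h2]
  omega

theorem formPerm_append_cons (l l' : List (Fin n)) (z : Fin n) :
    (l ++ z :: l').formPerm = (l ++ [z]).formPerm * (z :: l').formPerm := by
  induction l with
  | nil => simp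
  | cons y l ih =>
    cases l with
    | nil => simp [List.formPerm_cons_cons]
    | cons y' l =>
      simp only [List.cons_append, List.formPerm_cons_cons] at ih ⊢
      rw [ih, mul_assoc]

/-- Multiplication with a transposition splits a cycle into two. -/
theorem swap_mul_formPerm {x i : Fin n} {l l' : List (Fin n)}
    (h : (x :: (l ++ i :: l')).Nodup) :
    Equiv.swap x i * (x :: (l ++ i :: l')).formPerm = (x :: l).formPerm * (i :: l').formPerm := by
  obtain ⟨a, z, haz⟩ : ∃ a z, x :: l = a ++ [z] :=
    ⟨(x :: l).dropLast, (x :: l).getLast (by simp), (List.dropLast_append_getLast _).symm⟩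
  have hz : (x :: l).formPerm z = x := by
    have : z = (x :: l).getLast (by simp) := by simp [haz]
    rw [this, List.formPerm_apply_getLast]
  have hi : (x :: l).formPerm i = i := by
    apply List.formPerm_apply_of_notMem
    simp only [List.nodup_cons, List.nodup_append, List.mem_append, List.mem_cons] at h ⊢
    rintro (rfl | hil)
    · simp at h
    · exact h.2.2.2 i hil i (Or.inl rfl) rfl
  have h1 : (x :: (l ++ i :: l')).formPerm =
      (x :: l).formPerm * (Equiv.swap z i * (i :: l').formPerm) := by
    rw [← List.cons_append, haz, List.append_assoc, List.singleton_append, formPerm_append_cons,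
      List.formPerm_cons_cons]
  rw [h1, ← mul_assoc, ← mul_assoc, mul_assoc (Equiv.swap x i), Equiv.mul_swap_eq_swap_mul, hz, hi,
    Equiv.swap_mul_self_mul]

theorem prod_formPerm_apply_of_notMem {x : Fin n} (L : List (List (Fin n))) (h : x ∉ L.flatten) :
    (L.map List.formPerm).prod x = x := by
  induction L with
  | nil => simp
  | cons l L ih =>
    simp only [List.flatten_cons, List.mem_append, not_or] at h
    rw [List.map_cons, List.prod_cons, Equiv.Perm.mul_apply, ih h.2,
      List.formPerm_apply_of_notMem h.1]

theorem prod_formPerm_apply_mem_iff {l : List (Fin n)} {L : List (List (Fin n))}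
    (h : (l :: L).flatten.Nodup) (i : Fin n) :
    ((l :: L).map List.formPerm).prod i ∈ l ↔ i ∈ l := by
  rw [List.map_cons, List.prod_cons, Equiv.Perm.mul_apply, List.formPerm_mem_iff_mem]
  rw [List.flatten_cons, List.nodup_append] at h
  constructor
  · intro hi
    have h1 : (L.map List.formPerm).prod ((L.map List.formPerm).prod i) =
        (L.map List.formPerm).prod i :=
      prod_formPerm_apply_of_notMem L fun hm => h.2.2 _ hi _ hm rfl
    rwa [(L.map List.formPerm).prod.injective h1] at hi
  · intro hi
    rwa [prod_formPerm_apply_of_notMem L fun hm => h.2.2 _ hi _ hm rfl]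

/-- The number of permutations on a geodesic from the identity to a product of disjoint cycles is at
most the product of the Catalan numbers of their lengths. A point `x` of the first cycle `x :: m` is
removed: if `β` maps it to entry `k` of `m ++ [x]`, then `swap x (β x) * β` fixes `x` and lies below
the permutation in which `x` is deleted and the rest of its cycle is cut into two, of lengths `k`
and `m.length - k`; this is the recursion of the Catalan numbers. -/
theorem card_onGeodesic_prod_le (N : ℕ) : ∀ L : List (List (Fin n)), L.flatten.Nodup →
    2 * L.flatten.length + L.length = N →
    Nat.card {β // OnGeodesic β (L.map List.formPerm).prod} ≤
      (L.map fun l => catalan l.length).prod := by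
  classical
  induction N using Nat.strong_induction_on with | _ N IH
  intro L hL hN
  rcases L with - | ⟨l, L⟩
  · simp only [List.map_nil, List.prod_nil]
    rw [Nat.card_eq_fintype_card, Fintype.card_le_one_iff_subsingleton]
    exact ⟨fun a b => Subtype.ext ((onGeodesic_one a.2).trans (onGeodesic_one b.2).symm)⟩
  rcases l with - | ⟨x, m⟩
  · have := IH (N - 1) (by simp at hN; omega) L (by simpa using hL)
      (by simp only [List.flatten_cons, List.nil_append, List.length_cons] at hN; omega)
    simpa using this
  have hL' := hL
  simp only [List.flatten_cons, List.cons_append, List.nodup_cons, List.mem_append, not_or] at hL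
  obtain ⟨⟨hxm, hxL⟩, hmL⟩ := hL
  set τ := (L.map List.formPerm).prod with hτ
  have hτx : τ x = x := prod_formPerm_apply_of_notMem L hxL
  let S : Equiv.Perm (Fin n) → Finset (Equiv.Perm (Fin n)) :=
    fun σ => Finset.univ.filter fun β => OnGeodesic β σ
  have hS : ∀ σ, Nat.card {β // OnGeodesic β σ} = (S σ).card := by
    intro σ
    rw [Nat.card_eq_fintype_card, Fintype.card_subtype]
  set σ := (((x :: m) :: L).map List.formPerm).prod with hσ
  have hσ' : σ = (x :: m).formPerm * τ := by simp [hσ, hτ]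
  have htarget : ∀ k : Fin (m.length + 1), (k : ℕ) < (m ++ [x]).length := by
    intro k; have := k.2; simp; omega
  -- the last entry of `m ++ [x]` is the case in which `x` is a fixed point
  let T : Fin (m.length + 1) → Finset (Equiv.Perm (Fin n)) := fun k =>
    (S σ).filter fun β => β x = (m ++ [x])[(k : ℕ)]'(htarget k)
  have hcover : S σ ⊆ Finset.univ.biUnion T := by
    intro β hβ
    have hβ' : OnGeodesic β σ := by simpa [S] using hβ
    -- the indicator function of the cycle of `x` is invariant under `σ`, hence under `β`
    have hind : (fun i => if i ∈ x :: m then (1 : ℚ) else 0) ∈ invariantFunctions β := by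
      apply hβ'.invariantFunctions_le
      intro i
      have := prod_formPerm_apply_mem_iff hL' i
      simp only [hσ, this]
    have h1 := hind x
    have h2 : β x ∈ x :: m := by
      by_contra h
      simp only [h, if_false, List.mem_cons, true_or, if_true] at h1
      exact zero_ne_one h1
    have h3 : β x ∈ m ++ [x] := by
      simp only [List.mem_append, List.mem_cons, List.not_mem_nil, or_false] at h2 ⊢
      exact h2.symm
    obtain ⟨k, hk, hkx⟩ := List.getElem_of_mem h3
    simp only [Finset.mem_biUnion, Finset.mem_univ, true_and]
    refine ⟨⟨k, by simpa using hk⟩, ?_⟩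
    simp only [T, Finset.mem_filter]
    exact ⟨hβ, hkx.symm⟩
  have hT : ∀ k, (T k).card ≤
      catalan k * catalan (m.length - k) * (L.map fun l => catalan l.length).prod := by
    intro k
    have hnd : (m.take k :: m.drop k :: L).flatten.Nodup := by
      simpa [← List.append_assoc, List.take_append_drop] using hmL
    have hlen : 2 * (m.take k :: m.drop k :: L).flatten.length + (m.take k :: m.drop k :: L).length
        = N - 1 := by
      have : (m.take k).length + (m.drop k).length = m.length := by
        rw [← List.length_append, List.take_append_drop]
      simp only [List.flatten_cons, List.length_append, List.length_cons] at this hN ⊢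
      omega
    have h1 := IH (N - 1) (by simp at hN; omega) _ hnd hlen
    rw [hS] at h1
    have hklen : (m.take k).length = k := by
      rw [List.length_take]; omega
    simp only [List.map_cons, List.prod_cons, hklen, List.length_drop, ← hτ] at h1
    rw [mul_assoc]
    refine le_trans ?_ h1
    have hxt : x ∉ m.take k := fun h => hxm (List.mem_of_mem_take h)
    have hxd : x ∉ m.drop k := fun h => hxm (List.mem_of_mem_drop h)
    have hρx : ((m.drop k).formPerm * τ) x = x := by
      rw [Equiv.Perm.mul_apply, hτx, List.formPerm_apply_of_notMem hxd]
    refine Finset.card_le_card_of_injOn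
      (fun β => Equiv.swap x ((m ++ [x])[(k : ℕ)]'(htarget k)) * β) ?_
      (fun a _ b _ h => mul_left_cancel h)
    intro β hβ
    simp only [T, S, Finset.coe_filter, Finset.mem_filter, Finset.mem_univ, true_and,
      Set.mem_ofPred_eq] at hβ ⊢
    obtain ⟨hβ, hβx⟩ := hβ
    rw [← hβx]
    apply OnGeodesic.remove_fixed hxt (by simp) hρx
    by_cases hk : (k : ℕ) < m.length
    · have hget : β x = m[(k : ℕ)] := by
        rw [hβx, List.getElem_append_left hk]
      have hne : x ≠ β x := by
        rw [hget]; exact fun h => hxm (h ▸ List.getElem_mem hk)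
      have hm : m = m.take k ++ β x :: m.drop (k + 1) := by
        rw [hget, ← List.drop_eq_getElem_cons hk, List.take_append_drop]
      have hd : m.drop k = β x :: m.drop (k + 1) := by
        rw [hget, ← List.drop_eq_getElem_cons hk]
      have hxmn : (x :: m).Nodup := List.nodup_cons.2 ⟨hxm, (List.nodup_append.1 hmL).1⟩
      have hsplit : Equiv.swap x (β x) * (x :: m).formPerm =
          (x :: m.take k).formPerm * (m.drop k).formPerm := by
        rw [hd]
        conv_lhs => rw [hm]
        exact swap_mul_formPerm (hm ▸ hxmn)
      rw [← mul_assoc, ← hsplit, mul_assoc, ← hσ']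
      exact hβ.swap_mul rfl hne
    · have hk' : (k : ℕ) = m.length := by omega
      have hget : β x = x := by
        rw [hβx]; simp [hk']
      rw [hget, hk', List.take_length, List.drop_length, Equiv.swap_self, ← Equiv.Perm.one_def,
        one_mul]
      simpa [hσ'] using hβ
  rw [hS, List.map_cons, List.prod_cons, List.length_cons, catalan_succ, Finset.sum_mul]
  exact (Finset.card_le_card hcover).trans
    (Finset.card_biUnion_le.trans (Finset.sum_le_sum fun k _ => hT k))

theorem catalan_le_four_pow (n : ℕ) : catalan n ≤ 4 ^ n := by
  rw [catalan_eq_centralBinom_div]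
  refine (Nat.div_le_self _ _).trans ?_
  rw [Nat.centralBinom_eq_two_mul_choose]
  calc (2 * n).choose n ≤ 2 ^ (2 * n) := Nat.choose_le_two_pow _ _
    _ = 4 ^ n := by rw [pow_mul]; norm_num

theorem formPerm_finRange (n : ℕ) : (List.finRange n).formPerm = finRotate n := by
  ext i
  congr 1
  have h := List.formPerm_apply_getElem (List.finRange n) (List.nodup_finRange n) i (by simp)
  obtain ⟨m, rfl⟩ : ∃ m, n = m + 1 := ⟨n - 1, by have := i.2; omega⟩
  simp only [List.getElem_finRange, List.length_finRange] at h
  refine h.trans ?_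
  rw [finRotate_apply]
  ext
  simp [Fin.val_add]

theorem card_onGeodesic_fullCycle_le (n : ℕ) :
    Nat.card {β : Equiv.Perm (Fin n) // OnGeodesic β (fullCycle n)} ≤ 4 ^ n := by
  have h := card_onGeodesic_prod_le (n := n) _ [(List.finRange n).reverse]
    (by simpa using List.nodup_finRange n) rfl
  simp only [List.map_cons, List.map_nil, List.prod_cons, List.prod_nil, mul_one,
    List.formPerm_reverse, formPerm_finRange, List.length_reverse, List.length_finRange] at h
  exact h.trans (catalan_le_four_pow n)

end CayleyLength

namespace Multigraph

/-! ### Maximum flow and minimum cut -/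

variable {V E : Type*} {G : Multigraph V E}

/-- All steps of the walk are admissible: `R e b` allows `e` to be traversed from its end `b` to its
other end. -/
def Walk.Along (R : E → Bool → Prop) : {u v : V} → G.Walk u v → Prop
  | _, _, .nil _ => True
  | u, _, .cons (v := v) e _ p =>
      (∃ b, R e b ∧ G.ends e b = u ∧ G.ends e (!b) = v) ∧ p.Along R

theorem Walk.start_mem_support {u v : V} (p : G.Walk u v) : u ∈ p.support := by
  cases p <;> simp [Walk.support]

theorem Joins.mem_or {e : E} {u v : V} (h : G.Joins e u v) (b : Bool) :
    G.ends e b = u ∨ G.ends e b = v := by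
  rcases h with ⟨h1, h2⟩ | ⟨h1, h2⟩ <;> cases b <;> simp [h1, h2]

theorem joins_ends (G : Multigraph V E) (e : E) (b : Bool) :
    G.Joins e (G.ends e b) (G.ends e (!b)) := by
  cases b <;> simp [Joins]

theorem Walk.ends_mem_support {u v : V} (p : G.Walk u v) {e : E} (he : e ∈ p.edges) (b : Bool) :
    G.ends e b ∈ p.support := by
  induction p with
  | nil => simp [Walk.edges] at he
  | cons e' h p ih =>
    simp only [Walk.edges, List.mem_cons] at he
    simp only [Walk.support, List.mem_cons]
    rcases he with rfl | he
    · rcases h.mem_or b with h | h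
      · exact Or.inl h
      · exact Or.inr (h ▸ p.start_mem_support)
    · exact Or.inr (ih he)

theorem Walk.notMem_edges_of_nodup {u v w : V} {e : E} {h : G.Joins e u v} {p : G.Walk v w}
    (hp : (Walk.cons e h p).support.Nodup) : e ∉ p.edges := by
  intro he
  simp only [Walk.support, List.nodup_cons] at hp
  rcases h with h | h
  · exact hp.1 (h.1 ▸ p.ends_mem_support he false)
  · exact hp.1 (h.2 ▸ p.ends_mem_support he true)

theorem Walk.edges_nodup {u v : V} (p : G.Walk u v) (hp : p.support.Nodup) : p.edges.Nodup := by
  induction p with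
  | nil => simp [Walk.edges]
  | cons e h p ih =>
    simp only [Walk.edges, List.nodup_cons]
    exact ⟨Walk.notMem_edges_of_nodup hp, ih (List.nodup_cons.1 hp).2⟩

theorem Walk.exists_drop (R : E → Bool → Prop) {v w : V} (q : G.Walk v w) (hq : q.Along R)
    (hn : q.support.Nodup) {u : V} (hu : u ∈ q.support) :
    ∃ r : G.Walk u w, r.Along R ∧ r.support.Nodup := by
  induction q with
  | nil x =>
    simp only [Walk.support, List.mem_singleton] at hu
    subst hu
    exact ⟨.nil _, hq, hn⟩
  | cons e h p ih =>
    simp only [Walk.support, List.mem_cons] at hu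
    by_cases hup : u ∈ p.support
    · exact ih hq.2 (List.nodup_cons.1 hn).2 hup
    · obtain rfl : u = _ := hu.resolve_right hup
      exact ⟨.cons e h p, hq, hn⟩

theorem Walk.exists_path (R : E → Bool → Prop) {u v : V} (p : G.Walk u v) (hp : p.Along R) :
    ∃ q : G.Walk u v, q.Along R ∧ q.support.Nodup := by
  induction p with
  | nil x => exact ⟨.nil x, trivial, by simp [Walk.support]⟩
  | @cons u v w e h p ih =>
    obtain ⟨q, hq, hn⟩ := ih hp.2
    by_cases hu : u ∈ q.support
    · exact q.exists_drop R hq hn hu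
    · exact ⟨.cons e h q, ⟨hp.1, hq⟩, List.nodup_cons.2 ⟨hu, hn⟩⟩

/-- The value of a unit flow along an edge which is traversed from its end `b`. -/
def sign (b : Bool) : ℤ := if b then -1 else 1

section Divergence

variable [Fintype E] [DecidableEq V]

/-- The net flow out of the vertex `w`, where `f e` is the flow through `e` from its end `false` to
its end `true`. -/
def divergence (G : Multigraph V E) (f : E → ℤ) (w : V) : ℤ :=
  ∑ e, f e * ((if G.ends e false = w then 1 else 0) - (if G.ends e true = w then 1 else 0))

theorem divergence_add (f g : E → ℤ) (w : V) :
    G.divergence (f + g) w = G.divergence f w + G.divergence g w := by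
  simp [divergence, add_mul, Finset.sum_add_distrib]

theorem divergence_sub (f g : E → ℤ) (w : V) :
    G.divergence (f - g) w = G.divergence f w - G.divergence g w := by
  simp [divergence, sub_mul, Finset.sum_sub_distrib]

theorem sum_divergence (f : E → ℤ) (S : Finset V) :
    ∑ w ∈ S, G.divergence f w =
      ∑ e, f e * ((if G.ends e false ∈ S then 1 else 0) -
        (if G.ends e true ∈ S then 1 else 0)) := by
  simp only [divergence]
  rw [Finset.sum_comm]
  refine Finset.sum_congr rfl fun e _ => ?_
  rw [← Finset.mul_sum, Finset.sum_sub_distrib, Finset.sum_ite_eq, Finset.sum_ite_eq]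

/-- The unit flow along a path. -/
theorem Walk.exists_unitFlow [DecidableEq E] (R : E → Bool → Prop) {u v : V} (p : G.Walk u v)
    (hp : p.Along R) (hn : p.support.Nodup) :
    ∃ χ : E → ℤ, (∀ e, e ∉ p.edges → χ e = 0) ∧ (∀ e ∈ p.edges, ∃ b, R e b ∧ χ e = sign b) ∧
      ∀ w, G.divergence χ w = (if u = w then 1 else 0) - (if v = w then 1 else 0) := by
  induction p with
  | nil x => exact ⟨0, by simp, by simp [Walk.edges], by simp [divergence]⟩
  | @cons u v w e h p ih =>
    obtain ⟨χ, h0, h1, h2⟩ := ih hp.2 (List.nodup_cons.1 hn).2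
    obtain ⟨b, hb, hbu, hbv⟩ := hp.1
    have hep := Walk.notMem_edges_of_nodup hn
    refine ⟨χ + Pi.single e (sign b), ?_, ?_, ?_⟩
    · intro e' he'
      simp only [Walk.edges, List.mem_cons, not_or] at he'
      simp [h0 e' he'.2, he'.1]
    · intro e' he'
      simp only [Walk.edges, List.mem_cons] at he'
      rcases he' with rfl | he'
      · exact ⟨b, hb, by simp [h0 _ hep]⟩
      · obtain ⟨b', hb', hs⟩ := h1 e' he'
        have : e' ≠ e := fun h => hep (h ▸ he')
        exact ⟨b', hb', by simp [this, hs]⟩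
    · intro x
      rw [divergence_add, h2]
      have : G.divergence (Pi.single e (sign b)) x =
          (if u = x then 1 else 0) - (if v = x then 1 else 0) := by
        rw [divergence, Finset.sum_eq_single e]
        · subst hbu hbv
          cases b <;> simp [sign]
        · intro e' _ he'
          simp [he']
        · simp
      rw [this]
      ring

/-- An integral flow from `s` to `t` of value `k`, all edges having capacity one. -/
def IsFlow (G : Multigraph V E) (s t : V) (k : ℕ) (f : E → ℤ) : Prop :=
  (∀ e, -1 ≤ f e ∧ f e ≤ 1) ∧
    ∀ w, G.divergence f w = k * ((if s = w then 1 else 0) - (if t = w then 1 else 0))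

theorem IsFlow.sum_cut {s t : V} {k : ℕ} {f : E → ℤ} (hf : G.IsFlow s t k f) {S : Finset V}
    (hs : s ∈ S) (ht : t ∉ S) :
    ∑ e, f e * ((if G.ends e false ∈ S then 1 else 0) - (if G.ends e true ∈ S then 1 else 0))
      = k := by
  rw [← sum_divergence, Finset.sum_congr rfl fun w _ => hf.2 w, ← Finset.mul_sum,
    Finset.sum_sub_distrib, Finset.sum_ite_eq, Finset.sum_ite_eq, if_pos hs, if_neg ht]
  ring

/-- A flow of value `k` contains `k` edge-disjoint paths. -/
theorem IsFlow.exists_paths [Fintype V] [DecidableEq E] {s t : V} (k : ℕ) :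
    ∀ f : E → ℤ, G.IsFlow s t k f → ∃ P : Fin k → G.Path s t,
      (∀ i j, i ≠ j → List.Disjoint (P i).1.edges (P j).1.edges) ∧
      ∀ i, ∀ e ∈ (P i).1.edges, f e ≠ 0 := by
  classical
  induction k with
  | zero => exact fun f _ => ⟨fun i => i.elim0, fun i => i.elim0, fun i => i.elim0⟩
  | succ k ih =>
    intro f hf
    let R : E → Bool → Prop := fun e b => f e = sign b
    have hst : ∃ p : G.Walk s t, p.Along R := by
      by_contra hs
      -- no flow leaves the set of vertices from which `t` cannot be reached along the flow
      let S : Finset V := Finset.univ.filter fun v => ¬ ∃ p : G.Walk v t, p.Along R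
      have hcut := hf.sum_cut (S := S) (by simpa [S] using hs)
        (by simpa [S] using ⟨Walk.nil t, trivial⟩)
      have hclosed : ∀ e b, f e = sign b → G.ends e b ∈ S → G.ends e (!b) ∈ S := by
        intro e b hR hb
        simp only [S, Finset.mem_filter, Finset.mem_univ, true_and] at hb ⊢
        rintro ⟨p, hp⟩
        exact hb ⟨.cons e (G.joins_ends e b) p, ⟨b, hR, rfl, rfl⟩, hp⟩
      have hle : ∑ e, f e * ((if G.ends e false ∈ S then 1 else 0) -
          (if G.ends e true ∈ S then 1 else 0)) ≤ 0 := by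
        refine Finset.sum_nonpos fun e _ => ?_
        have h1 := hclosed e false
        have h2 := hclosed e true
        simp only [sign, Bool.not_false, Bool.not_true, if_true, Bool.false_eq_true, if_false]
          at h1 h2
        have h3 := hf.1 e
        split_ifs with ha hb hb
        · simp
        · have : f e ≠ 1 := fun h => hb (h1 h ha)
          omega
        · have : f e ≠ -1 := fun h => ha (h2 h hb)
          omega
        · simp
      push_cast at hcut
      omega
    obtain ⟨p0, hp0⟩ := hst
    obtain ⟨p, hp, hn⟩ := p0.exists_path R hp0
    obtain ⟨χ, h0, h1, h2⟩ := p.exists_unitFlow R hp hn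
    have hfχ : ∀ e ∈ p.edges, (f - χ) e = 0 := by
      intro e he
      obtain ⟨b, hb, hs⟩ := h1 e he
      simp only [R] at hb
      simp [hb, hs]
    have hfχ' : ∀ e, e ∉ p.edges → (f - χ) e = f e := by
      intro e he
      simp [h0 e he]
    obtain ⟨P, hP, hP'⟩ := ih (f - χ) ⟨fun e => by
        by_cases he : e ∈ p.edges
        · rw [hfχ e he]; omega
        · rw [hfχ' e he]; exact hf.1 e, fun w => by
        rw [divergence_sub, hf.2, h2]; push_cast; ring⟩
    have hdisj : ∀ i, List.Disjoint p.edges (P i).1.edges :=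
      fun i e he he' => hP' i e he' (hfχ e he)
    refine ⟨Fin.cons ⟨p, hn⟩ P, ?_, ?_⟩
    · intro i j
      refine Fin.cases ?_ (fun i => ?_) i <;> refine Fin.cases ?_ (fun j => ?_) j
      · simp
      · intro _; exact hdisj j
      · intro _; exact (hdisj i).symm
      · intro hij; exact hP i j (fun h => hij (congrArg _ h))
    · intro i
      refine Fin.cases ?_ (fun i => ?_) i
      · intro e he
        obtain ⟨b, hb, -⟩ := h1 e he
        rw [hb]
        cases b <;> simp [sign]
      · intro e he h
        apply hP' i e he
        by_cases hep : e ∈ p.edges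
        · exact hfχ e hep
        · rw [hfχ' e hep, h]

end Divergence

/-- **Max-flow min-cut**: some set of vertices which contains `s` and not `t` is left by at most
`maxflow` edges. -/
theorem exists_cut_le_maxflow [Finite V] [Finite E] (G : Multigraph V E) {s t : V} (hst : s ≠ t) :
    ∃ S : Set V, s ∈ S ∧ t ∉ S ∧
      Nat.card {e // ¬ (G.ends e false ∈ S ↔ G.ends e true ∈ S)} ≤ G.maxflow s t := by
  classical
  have := Fintype.ofFinite V
  have := Fintype.ofFinite E
  have hle : ∀ k f, G.IsFlow s t k f → k ≤ G.maxflow s t := by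
    intro k f hf
    obtain ⟨P, hP, -⟩ := hf.exists_paths
    exact (G.maxflow_isGreatest hst).2 ⟨P, hP⟩
  have hne : {k | ∃ f, G.IsFlow s t k f}.Nonempty :=
    ⟨0, 0, fun e => by simp, fun w => by simp [divergence]⟩
  have hbdd : BddAbove {k | ∃ f, G.IsFlow s t k f} :=
    ⟨G.maxflow s t, fun k ⟨f, hf⟩ => hle k f hf⟩
  obtain ⟨f, hf⟩ := Nat.sSup_mem hne hbdd
  have hmax : ∀ f', ¬ G.IsFlow s t (sSup {k | ∃ f, G.IsFlow s t k f} + 1) f' := by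
    intro f' hf'
    have := le_csSup hbdd (show _ ∈ {k | ∃ f, G.IsFlow s t k f} from ⟨f', hf'⟩)
    omega
  set k := sSup {k | ∃ f, G.IsFlow s t k f} with hk
  -- the admissible steps of the residual network of a maximal flow
  let R : E → Bool → Prop := fun e b => sign b * f e ≤ 0
  have hns : ¬ ∃ p : G.Walk s t, p.Along R := by
    rintro ⟨p0, hp0⟩
    obtain ⟨p, hp, hn⟩ := p0.exists_path R hp0
    obtain ⟨χ, h0, h1, h2⟩ := p.exists_unitFlow R hp hn
    refine hmax (f + χ) ⟨fun e => ?_, fun w => ?_⟩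
    · have h3 := hf.1 e
      by_cases he : e ∈ p.edges
      · obtain ⟨b, hb, hs⟩ := h1 e he
        simp only [Pi.add_apply, hs]
        simp only [R] at hb
        cases b <;> simp [sign] at hb ⊢ <;> omega
      · simpa [h0 e he] using h3
    · rw [divergence_add, hf.2, h2]; push_cast; ring
  let S : Finset V := Finset.univ.filter fun v => ¬ ∃ p : G.Walk v t, p.Along R
  have hsS : s ∈ S := by simpa [S] using hns
  have htS : t ∉ S := by simpa [S] using ⟨Walk.nil t, trivial⟩
  have hcut := hf.sum_cut hsS htS
  have hclosed : ∀ e b, sign b * f e ≤ 0 → G.ends e b ∈ S → G.ends e (!b) ∈ S := by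
    intro e b hR hb
    simp only [S, Finset.mem_filter, Finset.mem_univ, true_and] at hb ⊢
    rintro ⟨p, hp⟩
    exact hb ⟨.cons e (G.joins_ends e b) p, ⟨b, hR, rfl, rfl⟩, hp⟩
  refine ⟨S, hsS, htS, le_trans (le_of_eq ?_) (hle k f hf)⟩
  have hsum : (∑ e, f e * ((if G.ends e false ∈ S then 1 else 0) -
      (if G.ends e true ∈ S then 1 else 0))) =
      ∑ e, if ¬ (G.ends e false ∈ S ↔ G.ends e true ∈ S) then 1 else 0 := by
    refine Finset.sum_congr rfl fun e _ => ?_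
    have h1 := hclosed e false
    have h2 := hclosed e true
    simp only [sign, Bool.not_false, Bool.not_true, if_true, Bool.false_eq_true, if_false, one_mul,
      neg_one_mul, Left.neg_nonpos_iff] at h1 h2
    have h3 := hf.1 e
    by_cases ha : G.ends e false ∈ S <;> by_cases hb : G.ends e true ∈ S
    · simp [ha, hb]
    · have : ¬ f e ≤ 0 := fun h => hb (h1 h ha)
      simp [ha, hb]; omega
    · have : ¬ 0 ≤ f e := fun h => ha (h2 h hb)
      simp [ha, hb]; omega
    · simp [ha, hb]
  rw [hsum, Finset.sum_boole] at hcut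
  rw [Nat.card_eq_fintype_card, Fintype.card_subtype]
  simpa using hcut

end Multigraph

namespace Multigraph

/-! ### Lengths of edge-disjoint paths -/

variable {V E : Type*} {G : Multigraph V E}

theorem Walk.dist_add_dist_le {d : V → V → ℕ} (h0 : ∀ u, d u u = 0) (hc : ∀ u v, d u v = d v u)
    (ht : ∀ u v w, d u w ≤ d u v + d v w) {u v : V} (p : G.Walk u v) {x : V}
    (hx : x ∈ p.support) :
    d u x + d x v ≤ (p.edges.map fun e => d (G.ends e false) (G.ends e true)).sum := by
  induction p generalizing x with
  | nil y =>
    simp only [Walk.support, List.mem_singleton] at hx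
    simp [hx, h0]
  | @cons u v w e h p ih =>
    have he : d (G.ends e false) (G.ends e true) = d u v := by
      rcases h with ⟨h1, h2⟩ | ⟨h1, h2⟩
      · rw [h1, h2]
      · rw [h1, h2, hc]
    simp only [Walk.edges, List.map_cons, List.sum_cons, he]
    simp only [Walk.support, List.mem_cons] at hx
    rcases hx with rfl | hx
    · have h1 := ih p.start_mem_support
      have h2 := ht x v w
      rw [h0] at h1 ⊢
      omega
    · have h1 := ih hx
      have h2 := ht u v x
      omega

variable [Fintype E]

/-- Disjoint paths are at least as long as the distance of their ends, and each edge counts at most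
once. If the total length of all edges is as small as this allows, then the paths are geodesics and
all other edges have length zero. -/
theorem sum_dist_of_maxflow {s t : V} (hst : s ≠ t) {d : V → V → ℕ} (h0 : ∀ u, d u u = 0)
    (hc : ∀ u v, d u v = d v u) (ht : ∀ u v w, d u w ≤ d u v + d v w) :
    G.maxflow s t * d s t ≤ ∑ e, d (G.ends e false) (G.ends e true) ∧
    (∑ e, d (G.ends e false) (G.ends e true) = G.maxflow s t * d s t →
      ∀ e, d (G.ends e false) (G.ends e true) = 0 ∨
        ∀ b, d s (G.ends e b) + d (G.ends e b) t = d s t) := by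
  classical
  obtain ⟨P, hP⟩ := (G.maxflow_isGreatest hst).1
  set w : E → ℕ := fun e => d (G.ends e false) (G.ends e true) with hw
  have hnd : ∀ i, (P i).1.edges.Nodup := fun i => (P i).1.edges_nodup (P i).2
  have hsum : ∀ i, ((P i).1.edges.map w).sum = ∑ e ∈ (P i).1.edges.toFinset, w e :=
    fun i => (List.sum_toFinset w (hnd i)).symm
  have hlen : ∀ i, d s t ≤ ∑ e ∈ (P i).1.edges.toFinset, w e := by
    intro i
    have := (P i).1.dist_add_dist_le h0 hc ht (P i).1.start_mem_support
    rw [h0, zero_add, hsum] at this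
    exact this
  let U : Finset E := Finset.univ.biUnion fun i => (P i).1.edges.toFinset
  have hU : ∑ e ∈ U, w e = ∑ i, ∑ e ∈ (P i).1.edges.toFinset, w e := by
    apply Finset.sum_biUnion
    intro i _ j _ hij
    exact List.disjoint_toFinset_iff_disjoint.2 (hP i j hij)
  have hUle : ∑ e ∈ U, w e + ∑ e ∈ Uᶜ, w e = Finset.univ.sum w :=
    Finset.sum_add_sum_compl U w
  have hconst : ∑ _i : Fin (G.maxflow s t), d s t = G.maxflow s t * d s t := by simp
  have hge : G.maxflow s t * d s t ≤ ∑ i, ∑ e ∈ (P i).1.edges.toFinset, w e := by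
    rw [← hconst]
    exact Finset.sum_le_sum fun i _ => hlen i
  refine ⟨by omega, fun heq e => ?_⟩
  by_cases he : e ∈ U
  · right
    intro b
    obtain ⟨i, -, hi⟩ := Finset.mem_biUnion.1 he
    have heq' : ∑ i, ∑ e ∈ (P i).1.edges.toFinset, w e = ∑ _i : Fin (G.maxflow s t), d s t := by
      omega
    have h1 := (Finset.sum_eq_sum_iff_of_le fun i _ => hlen i).1 heq'.symm i (Finset.mem_univ i)
    have h2 := (P i).1.dist_add_dist_le h0 hc ht
      ((P i).1.ends_mem_support (List.mem_toFinset.1 hi) b)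
    rw [hsum, ← h1] at h2
    exact le_antisymm h2 (ht _ _ _)
  · left
    have h1 : ∑ e ∈ Uᶜ, w e = 0 := by omega
    exact Finset.sum_eq_zero_iff.1 h1 e (Finset.mem_compl.2 he)

end Multigraph

instance NetVertex.finite {V : Type*} [Finite V] : Finite (NetVertex V) :=
  Finite.of_injective (β := Option (Option V))
    (fun | .source => none | .sink => some none | .vertex x => some (some x))
    (by rintro (_ | _ | x) (_ | _ | y) h <;> simp_all)

/-! ### Ground states of the Hamiltonian -/

/-- The left-invariant distance of permutations given by the Cayley length. -/
noncomputable def cayleyDist {n : ℕ} (σ τ : Equiv.Perm (Fin n)) : ℕ := cayleyLength (σ⁻¹ * τ)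

section CayleyDist

variable {n : ℕ}

theorem cayleyDist_self (σ : Equiv.Perm (Fin n)) : cayleyDist σ σ = 0 := by
  rw [cayleyDist, inv_mul_cancel, cayleyLength_one]

theorem cayleyDist_comm (σ τ : Equiv.Perm (Fin n)) : cayleyDist σ τ = cayleyDist τ σ := by
  rw [cayleyDist, ← cayleyLength_inv, mul_inv_rev, inv_inv, cayleyDist]

theorem cayleyDist_triangle (σ τ υ : Equiv.Perm (Fin n)) :
    cayleyDist σ υ ≤ cayleyDist σ τ + cayleyDist τ υ := by
  have := cayleyLength_mul_le (σ⁻¹ * τ) (τ⁻¹ * υ)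
  rwa [mul_assoc, mul_inv_cancel_left] at this

theorem cayleyDist_one_fullCycle (hn : 1 ≤ n) : cayleyDist 1 (fullCycle n) = n - 1 := by
  rw [cayleyDist, inv_one, one_mul, cayleyLength_fullCycle hn]

end CayleyDist

namespace OpenGraph

variable {V Eb Eh : Type*} [Fintype Eb] [Fintype Eh] [DecidableEq Eh]

/-- The extension of a spin configuration to the network, with the boundary condition at source and
sink. -/
def networkSpin (n : ℕ) (α : V → Equiv.Perm (Fin n)) : NetVertex V → Equiv.Perm (Fin n)
  | .source => 1
  | .sink => fullCycle n
  | .vertex x => α x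

theorem hamiltonian_eq_sum (G : OpenGraph V Eb Eh) (A : Finset Eh) (n : ℕ)
    (α : V → Equiv.Perm (Fin n)) :
    G.hamiltonian A n α = ∑ e, cayleyDist (networkSpin n α ((G.network A).ends e false))
      (networkSpin n α ((G.network A).ends e true)) := by
  rw [hamiltonian, Fintype.sum_sum_type, add_comm, ← Finset.sum_add_sum_compl A]
  congr 1
  congr 1
  · refine Finset.sum_congr rfl fun h hh => ?_
    simp only [network, hh, if_true, networkSpin]
    rw [cayleyDist_comm]
    rfl
  · refine Finset.sum_congr rfl fun h hh => ?_
    simp only [network, Finset.mem_compl.1 hh, if_false, networkSpin]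
    rw [cayleyDist_comm]
    rfl

variable {n : ℕ}

theorem flow_mul_le_hamiltonian (G : OpenGraph V Eb Eh) (A : Finset Eh) (hn : 1 ≤ n)
    (α : V → Equiv.Perm (Fin n)) : G.flow A * (n - 1) ≤ G.hamiltonian A n α := by
  rw [hamiltonian_eq_sum, ← cayleyDist_one_fullCycle hn]
  exact (Multigraph.sum_dist_of_maxflow (G := G.network A) (s := .source) (t := .sink) (by simp)
    (d := fun u v => cayleyDist (networkSpin n α u) (networkSpin n α v))
    (fun _ => cayleyDist_self _) (fun _ _ => cayleyDist_comm _ _)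
    (fun _ _ _ => cayleyDist_triangle _ _ _)).1

theorem exists_cut [Finite V] (G : OpenGraph V Eb Eh) (A : Finset Eh) :
    ∃ S : Set (NetVertex V), .source ∈ S ∧ .sink ∉ S ∧
      Nat.card {e // ¬ ((G.network A).ends e false ∈ S ↔ (G.network A).ends e true ∈ S)} ≤
        G.flow A :=
  (G.network A).exists_cut_le_maxflow (by simp)

/-- The configuration with a single domain wall along a minimal cut attains the bound. -/
theorem exists_hamiltonian_le [Finite V] (G : OpenGraph V Eb Eh) (A : Finset Eh) (hn : 1 ≤ n) :
    ∃ α : V → Equiv.Perm (Fin n), G.hamiltonian A n α ≤ G.flow A * (n - 1) := by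
  classical
  obtain ⟨S, hs, ht, hS⟩ := G.exists_cut A
  let α : V → Equiv.Perm (Fin n) := fun x => if .vertex x ∈ S then 1 else fullCycle n
  have hα : ∀ u, networkSpin n α u = if u ∈ S then 1 else fullCycle n := by
    rintro (_ | _ | x)
    · simp [networkSpin, hs]
    · simp [networkSpin, ht]
    · rfl
  refine ⟨α, ?_⟩
  rw [hamiltonian_eq_sum]
  refine le_trans (le_of_eq ?_) (Nat.mul_le_mul_right _ hS)
  rw [Nat.card_eq_fintype_card, Fintype.card_subtype, Finset.card_filter, Finset.sum_mul]
  refine Finset.sum_congr rfl fun e _ => ?_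
  rw [hα, hα]
  by_cases h1 : (G.network A).ends e false ∈ S <;>
    by_cases h2 : (G.network A).ends e true ∈ S <;>
    simp only [h1, h2, if_true, if_false, cayleyDist_self, not_true, iff_true, iff_false,
      not_false_eq_true, zero_mul, one_mul]
  · exact cayleyDist_one_fullCycle hn
  · rw [cayleyDist_comm, cayleyDist_one_fullCycle hn]

theorem isMinimizer_iff [Finite V] (G : OpenGraph V Eb Eh) (A : Finset Eh) (hn : 1 ≤ n)
    (α : V → Equiv.Perm (Fin n)) :
    (∀ β, G.hamiltonian A n α ≤ G.hamiltonian A n β) ↔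
      G.hamiltonian A n α = G.flow A * (n - 1) := by
  constructor
  · intro h
    obtain ⟨β, hβ⟩ := G.exists_hamiltonian_le A hn
    exact le_antisymm ((h β).trans hβ) (G.flow_mul_le_hamiltonian A hn α)
  · intro h β
    rw [h]
    exact G.flow_mul_le_hamiltonian A hn β

theorem onGeodesic_of_hamiltonian_eq (G : OpenGraph V Eb Eh) (hG : G.bulk.Connected)
    (hEh : Nonempty Eh) (A : Finset Eh) (hn : 1 ≤ n) {α : V → Equiv.Perm (Fin n)}
    (hα : G.hamiltonian A n α = G.flow A * (n - 1)) (x : V) :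
    OnGeodesic (α x) (fullCycle n) := by
  let d : NetVertex V → NetVertex V → ℕ :=
    fun u v => cayleyDist (networkSpin n α u) (networkSpin n α v)
  have hself : ∀ u, d u u = 0 := fun _ => cayleyDist_self _
  have hcomm : ∀ u v, d u v = d v u := fun _ _ => cayleyDist_comm _ _
  have htri : ∀ u v w, d u w ≤ d u v + d v w := fun _ _ _ => cayleyDist_triangle _ _ _
  have hF := (Multigraph.sum_dist_of_maxflow (G := G.network A) (s := .source) (t := .sink)
    (by simp) hself hcomm htri).2
    (by rw [hamiltonian_eq_sum, ← cayleyDist_one_fullCycle hn] at hα; exact hα)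
  -- lying on a geodesic is inherited along all edges
  have hprop : ∀ e b, d .source ((G.network A).ends e b) + d ((G.network A).ends e b) .sink =
      d .source .sink → d .source ((G.network A).ends e (!b)) +
        d ((G.network A).ends e (!b)) .sink = d .source .sink := by
    intro e b hb
    rcases hF e with h | h
    · have h' : d ((G.network A).ends e b) ((G.network A).ends e (!b)) = 0 := by
        cases b
        · exact h
        · rw [hcomm]; exact h
      have h1 := htri .source ((G.network A).ends e b) ((G.network A).ends e (!b))
      have h2 := htri ((G.network A).ends e (!b)) ((G.network A).ends e b) .sink
      have h3 := htri .source ((G.network A).ends e (!b)) .sink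
      rw [hcomm ((G.network A).ends e (!b)) ((G.network A).ends e b)] at h2
      omega
    · exact h _
  obtain ⟨h⟩ := hEh
  have hroot : d .source (.vertex (G.root h)) + d (.vertex (G.root h)) .sink =
      d .source .sink := by
    refine hprop (.inr h) true ?_
    by_cases hA : h ∈ A <;> simp [network, hA, hself]
  obtain ⟨p⟩ := hG.2 (G.root h) x
  have hx : d .source (.vertex x) + d (.vertex x) .sink = d .source .sink := by
    clear_value d
    revert hroot
    generalize G.root h = y at p
    intro hy
    induction p with
    | nil => exact hy
    | cons e hj p ih =>
      apply ih
      rcases hj with ⟨h1, h2⟩ | ⟨h1, h2⟩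
      · have := hprop (.inl e) false
        simp only [network, Bool.not_false, h1, h2] at this
        exact this hy
      · have := hprop (.inl e) true
        simp only [network, Bool.not_true, h1, h2] at this
        exact this hy
  simpa [d, networkSpin, cayleyDist, OnGeodesic] using hx

theorem numMinimizers_le [Fintype V] (G : OpenGraph V Eb Eh) (hG : G.bulk.Connected)
    (hEh : Nonempty Eh) (A : Finset Eh) (hn : 1 ≤ n) :
    G.numMinimizers A n ≤ (4 ^ Fintype.card V) ^ n := by
  have h1 : G.numMinimizers A n ≤
      Nat.card (V → {β : Equiv.Perm (Fin n) // OnGeodesic β (fullCycle n)}) := by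
    refine Nat.card_le_card_of_injective (fun α x => ⟨α.1 x,
      G.onGeodesic_of_hamiltonian_eq hG hEh A hn ((G.isMinimizer_iff A hn _).1 α.2) x⟩) ?_
    intro α β h
    ext1
    funext x
    exact congrArg Subtype.val (congrFun h x)
  rw [Nat.card_fun, Nat.card_eq_fintype_card (α := V)] at h1
  refine h1.trans ((Nat.pow_le_pow_left (card_onGeodesic_fullCycle_le n) _).trans ?_)
  rw [← pow_mul, ← pow_mul, mul_comm]

end OpenGraph

/-! ### Moments of complex Gaussian variables -/

/-- The density of the standard complex Gaussian law. -/
theorem complexGaussian_eq_withDensity :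
    complexGaussian = (volume : Measure ℂ).withDensity
      (fun z => ENNReal.ofReal (Real.pi⁻¹ * Real.exp (-‖z‖ ^ 2))) := by
  have hv : (1 / 2 : NNReal) ≠ 0 := by norm_num
  have hmeas : Measurable fun p : ℝ × ℝ => (p.1 : ℂ) + (p.2 : ℂ) * Complex.I := by fun_prop
  have hdens : Measurable fun z : ℂ => ENNReal.ofReal (Real.pi⁻¹ * Real.exp (-‖z‖ ^ 2)) := by
    fun_prop
  have hg := measurable_gaussianPDF 0 (1 / 2)
  refine Measure.ext_of_lintegral _ fun f hf => ?_
  rw [complexGaussian, gaussianReal_of_var_ne_zero _ hv, prod_withDensity hg hg,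
    lintegral_map hf hmeas, lintegral_withDensity_eq_lintegral_mul _ (by fun_prop) (by fun_prop),
    lintegral_withDensity_eq_lintegral_mul _ hdens hf, ← Measure.volume_eq_prod,
    ← Complex.volume_preserving_equiv_real_prod.symm.lintegral_comp (by fun_prop)]
  refine lintegral_congr fun p => ?_
  have hp : Complex.measurableEquivRealProd.symm p = (p.1 : ℂ) + (p.2 : ℂ) * Complex.I := by
    rw [Complex.measurableEquivRealProd_symm_apply, Complex.mk_eq_add_mul_I]
  rw [hp]
  simp only [Pi.mul_apply]
  congr 1
  rw [gaussianPDF, gaussianPDF, ← ENNReal.ofReal_mul (gaussianPDFReal_nonneg _ _ _)]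
  congr 1
  rw [gaussianPDFReal, gaussianPDFReal, mul_mul_mul_comm, ← Real.exp_add, ← mul_inv,
    Real.mul_self_sqrt (by positivity), ← Complex.normSq_eq_norm_sq, Complex.normSq_add_mul_I]
  push_cast
  congr 2
  · ring
  · ring

instance isProbabilityMeasure_complexGaussian : IsProbabilityMeasure complexGaussian := by
  rw [complexGaussian]
  exact Measure.isProbabilityMeasure_map (by fun_prop)

theorem integral_complexGaussian {F : Type*} [NormedAddCommGroup F] [NormedSpace ℝ F] (f : ℂ → F) :
    ∫ z, f z ∂complexGaussian = ∫ z, (Real.pi⁻¹ * Real.exp (-‖z‖ ^ 2)) • f z := by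
  rw [complexGaussian_eq_withDensity, integral_withDensity_eq_integral_toReal_smul (by fun_prop)
    (by simp)]
  refine integral_congr_ae (Eventually.of_forall fun z => ?_)
  simp only
  rw [ENNReal.toReal_ofReal (by positivity)]

theorem integral_norm_pow_complexGaussian (k : ℕ) :
    ∫ z, ‖z‖ ^ k ∂complexGaussian = Real.Gamma (((k : ℝ) + 2) / 2) := by
  rw [integral_complexGaussian]
  have h := Complex.integral_rpow_mul_exp_neg_rpow (p := 2) (q := k) (by norm_num)
    (by have : (0 : ℝ) ≤ k := Nat.cast_nonneg k
        linarith)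
  rw [mul_div_cancel_left₀ _ (by norm_num : (2 : ℝ) ≠ 0)] at h
  calc ∫ z : ℂ, (Real.pi⁻¹ * Real.exp (-‖z‖ ^ 2)) • ‖z‖ ^ k
      = ∫ z : ℂ, Real.pi⁻¹ * (‖z‖ ^ (k : ℝ) * Real.exp (-‖z‖ ^ (2 : ℝ))) := by
        congr 1
        funext z
        rw [Real.rpow_natCast, Real.rpow_ofNat, smul_eq_mul]
        ring
    _ = _ := by
        rw [integral_const_mul, h, ← mul_assoc, inv_mul_cancel₀ Real.pi_ne_zero, one_mul]

theorem integrable_norm_pow_complexGaussian (k : ℕ) :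
    Integrable (fun z : ℂ => ‖z‖ ^ k) complexGaussian := by
  apply Integrable.of_integral_ne_zero
  rw [integral_norm_pow_complexGaussian]
  exact (Real.Gamma_pos_of_pos (by positivity)).ne'

theorem integrable_pow_mul_star_pow (p q : ℕ) :
    Integrable (fun z : ℂ => z ^ p * star z ^ q) complexGaussian := by
  refine (integrable_norm_pow_complexGaussian (p + q)).mono' (by fun_prop) ?_
  refine Eventually.of_forall fun z => ?_
  rw [norm_mul, norm_pow, norm_pow, norm_star, pow_add]

/-- The mixed moments of a standard complex Gaussian variable: the moments with `p ≠ q` vanish by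
rotation invariance. -/
theorem integral_pow_mul_star_pow (p q : ℕ) :
    ∫ z, z ^ p * star z ^ q ∂complexGaussian = if p = q then (p.factorial : ℂ) else 0 := by
  split_ifs with hpq
  · subst hpq
    have h := integral_norm_pow_complexGaussian (2 * p)
    have h2 : (((2 * p : ℕ) : ℝ) + 2) / 2 = p + 1 := by push_cast; ring
    rw [h2, Real.Gamma_nat_eq_factorial] at h
    calc ∫ z, z ^ p * star z ^ p ∂complexGaussian
        = ∫ z : ℂ, ((‖z‖ ^ (2 * p) : ℝ) : ℂ) ∂complexGaussian := by
          congr 1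
          funext z
          rw [← mul_pow, Complex.star_def, Complex.mul_conj, Complex.normSq_eq_norm_sq, pow_mul]
          push_cast
          rfl
      _ = _ := by
          rw [integral_complex_ofReal, h]
          simp
  · rw [integral_complexGaussian]
    set I := ∫ z : ℂ, (Real.pi⁻¹ * Real.exp (-‖z‖ ^ 2)) • (z ^ p * star z ^ q) with hI
    let θ : ℝ := Real.pi / ((p : ℝ) - q)
    let a : Circle := Circle.exp θ
    have hne : ((p : ℂ) - q) ≠ 0 := sub_ne_zero.2 (by exact_mod_cast hpq)
    have ha : (a : ℂ) ^ p * star (a : ℂ) ^ q = -1 := by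
      simp only [a, Circle.coe_exp, Complex.star_def, ← Complex.exp_conj, ← Complex.exp_nat_mul,
        ← Complex.exp_add]
      rw [← Complex.exp_pi_mul_I]
      congr 1
      simp only [θ, map_mul, Complex.conj_I, Complex.conj_ofReal]
      push_cast
      field_simp
      ring
    have h1 : I = -I := by
      calc I = ∫ z : ℂ, (Real.pi⁻¹ * Real.exp (-‖rotation a z‖ ^ 2)) •
            (rotation a z ^ p * star (rotation a z) ^ q) :=
            ((rotation a).measurePreserving.integral_comp
              (rotation a).toHomeomorph.measurableEmbedding
              (fun z => (Real.pi⁻¹ * Real.exp (-‖z‖ ^ 2)) • (z ^ p * star z ^ q))).symm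
        _ = ∫ z : ℂ, -((Real.pi⁻¹ * Real.exp (-‖z‖ ^ 2)) • (z ^ p * star z ^ q)) := by
            congr 1
            funext z
            rw [LinearIsometryEquiv.norm_map, rotation_apply, star_mul', mul_pow, mul_pow,
              mul_mul_mul_comm, ha, neg_one_mul, smul_neg]
        _ = -I := integral_neg _
    have h2 : (2 : ℂ) * I = 0 := by linear_combination h1
    simpa using h2

/-- **Wick's formula** for independent standard complex Gaussian variables: the moment of the
variables with indices `f k` and of the conjugates of those with indices `f' k` counts the pairings
of equal indices. -/
theorem integral_prod_mul_star_prod {I : Type*} [Fintype I] {n : ℕ} (f f' : Fin n → I) :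
    Integrable (fun z : I → ℂ => (∏ k, z (f k)) * ∏ k, star (z (f' k)))
      (Measure.pi fun _ => complexGaussian) ∧
    ∫ z : I → ℂ, (∏ k, z (f k)) * ∏ k, star (z (f' k)) ∂(Measure.pi fun _ => complexGaussian) =
      (Nat.card {σ : Equiv.Perm (Fin n) // ∀ k, f' (σ k) = f k} : ℂ) := by
  classical
  let c : (Fin n → I) → I → ℕ := fun f i => Fintype.card {k // f k = i}
  have hpow : ∀ (f : Fin n → I) (w : I → ℂ), ∏ k, w (f k) = ∏ i, w i ^ c f i := by
    intro f w
    rw [← Finset.prod_fiberwise' Finset.univ f]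
    refine Finset.prod_congr rfl fun i _ => ?_
    rw [Finset.prod_const]
    simp only [c, Fintype.card_subtype]
  have hfun : (fun z : I → ℂ => (∏ k, z (f k)) * ∏ k, star (z (f' k))) =
      fun z => ∏ i, (z i ^ c f i * star (z i) ^ c f' i) := by
    funext z
    rw [hpow f z, hpow f' (fun i => star (z i)), Finset.prod_mul_distrib]
  rw [hfun]
  refine ⟨Integrable.fintype_prod fun i => integrable_pow_mul_star_pow _ _, ?_⟩
  rw [integral_fintype_prod_eq_prod (fun i (w : ℂ) => w ^ c f i * star w ^ c f' i)]
  simp only [integral_pow_mul_star_pow]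
  by_cases hc : c f = c f'
  · have h1 : ∀ i, Nonempty ({k // f k = i} ≃ {k // f' k = i}) :=
      fun i => ⟨Fintype.equivOfCardEq (congrFun hc i)⟩
    let σ₀ : Equiv.Perm (Fin n) := Equiv.ofFiberEquiv fun i => (h1 i).some
    have hσ₀ : ∀ k, f' (σ₀ k) = f k := Equiv.ofFiberEquiv_map _
    have heq : Nat.card {σ : Equiv.Perm (Fin n) // ∀ k, f' (σ k) = f k} =
        Nat.card {τ : Equiv.Perm (Fin n) // f ∘ τ = f} := by
      refine Nat.card_congr (((Equiv.mulLeft σ₀).subtypeEquiv fun τ => ?_).symm)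
      rw [funext_iff]
      refine forall_congr' fun k => ?_
      rw [Equiv.coe_mulLeft, Equiv.Perm.mul_apply, hσ₀]
      rfl
    rw [heq, Nat.card_eq_fintype_card, DomMulAct.stabilizer_card, Nat.cast_prod]
    refine Finset.prod_congr rfl fun i _ => ?_
    rw [if_pos (congrFun hc i)]
  · obtain ⟨i, hi⟩ := Function.ne_iff.1 hc
    rw [Finset.prod_eq_zero (Finset.mem_univ i) (if_neg hi)]
    have : IsEmpty {σ : Equiv.Perm (Fin n) // ∀ k, f' (σ k) = f k} := by
      refine ⟨fun σ => hi (Fintype.card_congr (σ.1.subtypeEquiv fun k => ?_))⟩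
      rw [σ.2]
    simp

/-! ### Expansion of the moments of the reduced density matrix -/

theorem matrix_pow_succ_apply {ι R : Type*} [Fintype ι] [DecidableEq ι] [CommSemiring R]
    (M : Matrix ι ι R) (n : ℕ) : ∀ i j, (M ^ (n + 1)) i j =
      ∑ a : Fin n → ι, ∏ k : Fin (n + 1),
        M ((Fin.cons i a : Fin (n + 1) → ι) k) ((Fin.snoc a j : Fin (n + 1) → ι) k) := by
  induction n with
  | zero =>
    intro i j
    simp [Fin.snoc]
  | succ n ih =>
    intro i j
    rw [pow_succ', Matrix.mul_apply, ← (Fin.consEquiv fun _ : Fin (n + 1) => ι).sum_comp,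
      Fintype.sum_prod_type]
    refine Finset.sum_congr rfl fun l _ => ?_
    rw [ih, Finset.mul_sum]
    refine Finset.sum_congr rfl fun a _ => ?_
    rw [Fin.prod_univ_succ (n := n + 1)]
    have h : (Fin.snoc (Fin.cons l a : Fin (n + 1) → ι) j : Fin (n + 2) → ι) =
        Fin.cons l (Fin.snoc a j : Fin (n + 1) → ι) := (Fin.cons_snoc_eq_snoc_cons l a j).symm
    simp only [Fin.cons_zero, Fin.cons_succ]
    change _ = M i ((Fin.snoc (Fin.cons l a : Fin (n + 1) → ι) j : Fin (n + 2) → ι) 0) *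
      ∏ x : Fin (n + 1), M ((Fin.cons l a : Fin (n + 1) → ι) x)
        ((Fin.snoc (Fin.cons l a : Fin (n + 1) → ι) j : Fin (n + 2) → ι) x.succ)
    rw [h]
    simp only [Fin.cons_zero, Fin.cons_succ]

theorem matrix_trace_pow {ι R : Type*} [Fintype ι] [DecidableEq ι] [CommSemiring R]
    (M : Matrix ι ι R) {n : ℕ} (hn : 1 ≤ n) :
    (M ^ n).trace = ∑ a : Fin n → ι, ∏ k, M (a k) (a (finRotate n k)) := by
  obtain ⟨m, rfl⟩ : ∃ m, n = m + 1 := ⟨n - 1, by omega⟩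
  rw [Matrix.trace, ← (Fin.consEquiv fun _ : Fin (m + 1) => ι).sum_comp, Fintype.sum_prod_type]
  refine Finset.sum_congr rfl fun i _ => ?_
  rw [Matrix.diag_apply, matrix_pow_succ_apply]
  refine Finset.sum_congr rfl fun a _ => Finset.prod_congr rfl fun k _ => ?_
  rw [Fin.snoc_eq_cons_rotate]
  rfl

namespace OpenGraph

variable {V Eb Eh : Type*}

/-- The labels of the legs at `x` when the bulk edges are labelled by `κ` and the half-edges by
`i`. -/
def legLabel (G : OpenGraph V Eb Eh) {D : ℕ} (κ : Eb → Fin D) (i : Eh → Fin D) (x : V) :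
    G.LegsAt x → Fin D :=
  fun l => Sum.elim (fun p : Eb × Bool => κ p.1) i l.1

section CompatibleLabels

variable [DecidableEq Eh]

/-- The permutation of the replicas by which the half-edge `h` is contracted in the trace of the
`n`-th power of the reduced density matrix. -/
def boundaryTwist (A : Finset Eh) (n : ℕ) (h : Eh) : Equiv.Perm (Fin n) :=
  if h ∈ A then finRotate n else 1

variable [Fintype Eb] [Fintype Eh]

/-- The labellings which are compatible with the spin configuration `α`: one label is free for every
cycle of a relative permutation along an edge. -/
theorem card_compatible_labels (G : OpenGraph V Eb Eh) (A : Finset Eh) {D n : ℕ}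
    (α : V → Equiv.Perm (Fin n)) :
    Nat.card {q : (Fin n → Eh → Fin D) × (Fin n → Eb → Fin D) × (Fin n → Eb → Fin D) //
      ∀ x k, G.legLabel (q.2.2 (α x k)) (fun h => q.1 (boundaryTwist A n h (α x k)) h) x =
        G.legLabel (q.2.1 k) (q.1 k) x} * D ^ G.hamiltonian A n α =
      D ^ (n * Fintype.card Eh) * D ^ (n * Fintype.card Eb) := by
  let X : Eh → Type := fun h =>
    {c : Fin n → Fin D // ∀ k, c ((boundaryTwist A n h * α (G.root h)) k) = c k}
  let Y : Eb → Type := fun e => {c : Fin n → Fin D //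
    ∀ k, c (((α (G.bulk.ends e false))⁻¹ * α (G.bulk.ends e true)) k) = c k}
  let E : {q : (Fin n → Eh → Fin D) × (Fin n → Eb → Fin D) × (Fin n → Eb → Fin D) //
      ∀ x k, G.legLabel (q.2.2 (α x k)) (fun h => q.1 (boundaryTwist A n h (α x k)) h) x =
        G.legLabel (q.2.1 k) (q.1 k) x} ≃ (∀ h, X h) × (∀ e, Y e) :=
    { toFun := fun q => (fun h => ⟨fun k => q.1.1 k h, fun k =>
          congrFun (q.2 (G.root h) k) ⟨.inr h, rfl⟩⟩,
        fun e => ⟨fun k => q.1.2.1 k e, fun k => by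
          have h1 := congrFun (q.2 (G.bulk.ends e true) k) ⟨.inl (e, true), rfl⟩
          have h2 := congrFun (q.2 (G.bulk.ends e false)
            ((α (G.bulk.ends e false))⁻¹ (α (G.bulk.ends e true) k))) ⟨.inl (e, false), rfl⟩
          simp only [legLabel, Sum.elim_inl, Equiv.Perm.mul_apply] at h1 h2 ⊢
          rw [← h2, ← h1]
          simp⟩)
      invFun := fun p => ⟨(fun k h => (p.1 h).1 k, fun k e => (p.2 e).1 k,
          fun k e => (p.2 e).1 ((α (G.bulk.ends e false))⁻¹ k)), by
        rintro x k
        funext ⟨l, hl⟩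
        rcases l with ⟨e, b⟩ | h
        · simp only [legVertex] at hl
          subst hl
          cases b
          · simp [legLabel]
          · exact (p.2 e).2 k
        · simp only [legVertex] at hl
          subst hl
          exact (p.1 h).2 k⟩
      left_inv := fun q => by
        refine Subtype.ext (Prod.ext rfl (Prod.ext rfl ?_))
        funext k e
        have h2 := congrFun (q.2 (G.bulk.ends e false)
          ((α (G.bulk.ends e false))⁻¹ k)) ⟨.inl (e, false), rfl⟩
        simp only [legLabel, Sum.elim_inl] at h2 ⊢
        rw [← h2]
        simp
      right_inv := fun p => rfl }
  rw [Nat.card_congr E, Nat.card_prod, Nat.card_pi, Nat.card_pi]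
  simp only [X, Y, card_invariant]
  rw [hamiltonian, pow_add, mul_mul_mul_comm]
  congr 1
  · rw [mul_comm n, pow_mul', ← Finset.card_univ (α := Eh), ← Finset.prod_const,
      ← Finset.prod_mul_prod_compl A (fun h => D ^ numCycles (boundaryTwist A n h * α (G.root h))),
      ← Finset.prod_mul_prod_compl A (fun _ => D ^ n), pow_add, mul_mul_mul_comm]
    congr 1
    · rw [← Finset.prod_pow_eq_pow_sum, ← Finset.prod_mul_distrib]
      refine Finset.prod_congr rfl fun h hh => ?_
      rw [boundaryTwist, if_pos hh, fullCycle, inv_inv, ← pow_add, add_comm,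
        cayleyLength_add_numCycles]
    · rw [← Finset.prod_pow_eq_pow_sum, ← Finset.prod_mul_distrib]
      refine Finset.prod_congr rfl fun h hh => ?_
      rw [boundaryTwist, if_neg (Finset.mem_compl.1 hh), inv_one, ← pow_add, add_comm,
        cayleyLength_add_numCycles]
  · rw [mul_comm n, pow_mul', ← Finset.card_univ (α := Eb), ← Finset.prod_const,
      ← Finset.prod_pow_eq_pow_sum, ← Finset.prod_mul_distrib]
    refine Finset.prod_congr rfl fun h hh => ?_
    rw [← pow_add, add_comm, cayleyLength_add_numCycles]

end CompatibleLabels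

section Tensor

variable [Fintype V] [Fintype Eb] [DecidableEq Eb]

/-- The entangled pairs identify the labels of the two ends of every bulk edge. -/
theorem tensor_eq_sum (G : OpenGraph V Eb Eh) {D : ℕ} (g : G.VertexTensors D) (i : Eh → Fin D) :
    G.tensor g i = ((1 / Real.sqrt (D : ℝ) : ℝ) : ℂ) ^ Fintype.card Eb *
      ∑ κ : Eb → Fin D, ∏ x, g x (G.legLabel κ i x) := by
  rw [tensor, Finset.mul_sum]
  refine (Fintype.sum_of_injective (fun (κ : Eb → Fin D) (p : Eb × Bool) => κ p.1) ?_ _ _ ?_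
    ?_).symm
  · intro κ κ' h
    funext e
    exact congrFun h (e, false)
  · intro j hj
    have : ∃ e, j (e, false) ≠ j (e, true) := by
      by_contra! h
      refine hj ⟨fun e => j (e, false), ?_⟩
      funext ⟨e, b⟩
      cases b
      · rfl
      · exact h e
    obtain ⟨e, he⟩ := this
    rw [Finset.prod_eq_zero (Finset.mem_univ e) (by rw [entangled, if_neg he]), star_zero,
      zero_mul]
  · intro κ
    simp only [entangled, if_true, Finset.prod_const, Finset.card_univ, star_pow]
    congr 2
    exact (Complex.conj_ofReal _).symm

end Tensor

variable [Fintype V] [Fintype Eb] [DecidableEq Eb] [Fintype Eh] [DecidableEq Eh]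

theorem trace_reducedDensity_pow (G : OpenGraph V Eb Eh) (A : Finset Eh) {D n : ℕ} (hn : 1 ≤ n)
    (g : G.VertexTensors D) :
    ((G.reducedDensity A g) ^ n).trace = ∑ i : Fin n → Eh → Fin D,
      ∏ k, G.tensor g (i k) * star (G.tensor g fun h => i (boundaryTwist A n h k) h) := by
  rw [matrix_trace_pow _ hn]
  simp only [reducedDensity, partialTrace, Matrix.vecMulVec_apply, Pi.star_apply]
  simp only [Finset.prod_univ_sum, Fintype.piFinset_univ]
  rw [← Fintype.sum_prod_type']
  let e : (Fin n → Eh → Fin D) ≃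
      (Fin n → {h // h ∈ A} → Fin D) × (Fin n → {h // h ∉ A} → Fin D) :=
    { toFun := fun i => (fun k h => i k h, fun k h => i k h)
      invFun := fun p k h => if hA : h ∈ A then p.1 k ⟨h, hA⟩ else p.2 k ⟨h, hA⟩
      left_inv := fun i => by funext k h; simp
      right_inv := fun p => by
        ext k h <;> simp [h.2] }
  rw [← e.sum_comp]
  refine Finset.sum_congr rfl fun i _ => Finset.prod_congr rfl fun k _ => ?_
  congr 2
  · funext h
    by_cases hA : h ∈ A <;> simp [e, hA]
  · congr 1
    funext h
    by_cases hA : h ∈ A <;> simp [e, hA, boundaryTwist]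

theorem trace_reducedDensity_pow_eq_sum (G : OpenGraph V Eb Eh) (A : Finset Eh) {D n : ℕ}
    (hn : 1 ≤ n) (g : G.VertexTensors D) :
    ((G.reducedDensity A g) ^ n).trace =
      (((1 / Real.sqrt (D : ℝ) : ℝ) : ℂ) ^ Fintype.card Eb) ^ n *
      (((1 / Real.sqrt (D : ℝ) : ℝ) : ℂ) ^ Fintype.card Eb) ^ n *
      ∑ i : Fin n → Eh → Fin D, ∑ κ : Fin n → Eb → Fin D, ∑ κ' : Fin n → Eb → Fin D,
        ∏ x, ((∏ k, g x (G.legLabel (κ k) (i k) x)) *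
          ∏ k, star (g x (G.legLabel (κ' k) (fun h => i (boundaryTwist A n h k) h) x))) := by
  rw [trace_reducedDensity_pow G A hn, Finset.mul_sum]
  refine Finset.sum_congr rfl fun i _ => ?_
  simp only [tensor_eq_sum, star_mul', star_pow, star_sum]
  rw [show star (((1 / Real.sqrt (D : ℝ) : ℝ) : ℂ)) = ((1 / Real.sqrt (D : ℝ) : ℝ) : ℂ) from
    Complex.conj_ofReal _]
  simp only [Finset.prod_mul_distrib, Finset.prod_const, Finset.card_univ, Fintype.card_fin,
    Finset.prod_univ_sum, Fintype.piFinset_univ]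
  rw [mul_mul_mul_comm]
  congr 1
  rw [Finset.sum_mul_sum]
  refine Finset.sum_congr rfl fun κ _ => Finset.sum_congr rfl fun κ' _ => ?_
  rw [Finset.prod_comm]
  congr 1
  simp only [star_prod]
  rw [Finset.prod_comm]

variable [DecidableEq V]

instance isProbabilityMeasure_gaussianLaw (G : OpenGraph V Eb Eh) (D : ℕ) :
    IsProbabilityMeasure (G.gaussianLaw D) := by
  unfold gaussianLaw
  infer_instance

/-- Independence of the vertex tensors and Wick's formula at every vertex. -/
theorem integral_prod_vertices (G : OpenGraph V Eb Eh) {D n : ℕ}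
    (f f' : (x : V) → Fin n → (G.LegsAt x → Fin D)) :
    Integrable (fun g : G.VertexTensors D =>
      ∏ x, ((∏ k, g x (f x k)) * ∏ k, star (g x (f' x k)))) (G.gaussianLaw D) ∧
    ∫ g : G.VertexTensors D, ∏ x, ((∏ k, g x (f x k)) * ∏ k, star (g x (f' x k)))
      ∂(G.gaussianLaw D) =
      (Nat.card {α : V → Equiv.Perm (Fin n) // ∀ x k, f' x (α x k) = f x k} : ℂ) := by
  constructor
  · exact Integrable.fintype_prod_dep fun x => (integral_prod_mul_star_prod (f x) (f' x)).1
  · refine (integral_fintype_prod_eq_prod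
      (fun x (z : (G.LegsAt x → Fin D) → ℂ) => (∏ k, z (f x k)) * ∏ k, star (z (f' x k)))).trans ?_
    rw [Nat.card_congr (Equiv.subtypePiEquivPi
      (p := fun x (σ : Equiv.Perm (Fin n)) => ∀ k, f' x (σ k) = f x k)), Nat.card_pi,
      Nat.cast_prod]
    exact Finset.prod_congr rfl fun x _ => (integral_prod_mul_star_prod (f x) (f' x)).2

theorem integrable_trace_reducedDensity_pow (G : OpenGraph V Eb Eh) (A : Finset Eh) {D n : ℕ}
    (hn : 1 ≤ n) :
    Integrable (fun g : G.VertexTensors D => ((G.reducedDensity A g) ^ n).trace)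
      (G.gaussianLaw D) := by
  simp only [trace_reducedDensity_pow_eq_sum G A hn]
  refine Integrable.const_mul (integrable_finsetSum _ fun i _ => integrable_finsetSum _ fun κ _ =>
    integrable_finsetSum _ fun κ' _ => ?_) _
  exact (G.integral_prod_vertices (fun x k => G.legLabel (κ k) (i k) x)
    (fun x k => G.legLabel (κ' k) (fun h => i (boundaryTwist A n h k) h) x)).1

/-- The moments of the reduced density matrix as the partition function of the spin model with
weight `D ^ (-H α)`. -/
theorem integral_trace_reducedDensity_pow (G : OpenGraph V Eb Eh) (A : Finset Eh) {D n : ℕ}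
    (hn : 1 ≤ n) (hD : D ≠ 0) :
    ∫ g : G.VertexTensors D, ((G.reducedDensity A g) ^ n).trace ∂(G.gaussianLaw D) =
      ∑ α : V → Equiv.Perm (Fin n),
        (D : ℂ) ^ (n * Fintype.card Eh) * ((D : ℂ) ^ G.hamiltonian A n α)⁻¹ := by
  classical
  have hDC : (D : ℂ) ≠ 0 := by exact_mod_cast hD
  simp only [trace_reducedDensity_pow_eq_sum G A hn]
  have hint : ∀ (i : Fin n → Eh → Fin D) (κ κ' : Fin n → Eb → Fin D), _ := fun i κ κ' =>
    G.integral_prod_vertices (fun x k => G.legLabel (κ k) (i k) x)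
      (fun x k => G.legLabel (κ' k) (fun h => i (boundaryTwist A n h k) h) x)
  rw [integral_const_mul, integral_finsetSum _ fun i _ => integrable_finsetSum _ fun κ _ =>
    integrable_finsetSum _ fun κ' _ => (hint i κ κ').1]
  simp_rw [integral_finsetSum _ fun κ _ => integrable_finsetSum _ fun κ' _ => (hint _ κ κ').1,
    integral_finsetSum _ fun κ' _ => (hint _ _ κ').1, fun i κ κ' => (hint i κ κ').2]
  have hc : (((1 / Real.sqrt (D : ℝ) : ℝ) : ℂ) ^ Fintype.card Eb) ^ n *
      (((1 / Real.sqrt (D : ℝ) : ℝ) : ℂ) ^ Fintype.card Eb) ^ n =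
      ((D : ℂ) ^ (n * Fintype.card Eb))⁻¹ := by
    rw [← mul_pow, ← mul_pow, ← Complex.ofReal_mul, one_div, ← mul_inv,
      Real.mul_self_sqrt (Nat.cast_nonneg D), ← pow_mul, mul_comm n]
    push_cast
    rw [inv_pow]
  have hswap : (∑ i : Fin n → Eh → Fin D, ∑ κ : Fin n → Eb → Fin D, ∑ κ' : Fin n → Eb → Fin D,
      Nat.card {α : V → Equiv.Perm (Fin n) // ∀ x k,
        G.legLabel (κ' (α x k)) (fun h => i (boundaryTwist A n h (α x k)) h) x =
          G.legLabel (κ k) (i k) x}) =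
      ∑ α : V → Equiv.Perm (Fin n),
        Nat.card {q : (Fin n → Eh → Fin D) × (Fin n → Eb → Fin D) × (Fin n → Eb → Fin D) //
          ∀ x k, G.legLabel (q.2.2 (α x k)) (fun h => q.1 (boundaryTwist A n h (α x k)) h) x =
            G.legLabel (q.2.1 k) (q.1 k) x} := by
    simp only [Nat.card_eq_fintype_card, Fintype.card_subtype, Finset.card_filter]
    refine Eq.trans ?_ Finset.sum_comm
    simp only [Fintype.sum_prod_type]
  have hswap' := congrArg (Nat.cast (R := ℂ)) hswap
  push_cast at hswap'
  rw [hc, hswap', Finset.mul_sum]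
  refine Finset.sum_congr rfl fun α _ => ?_
  have hcard := congrArg (Nat.cast (R := ℂ)) (G.card_compatible_labels A (D := D) α)
  push_cast at hcard
  rw [inv_mul_eq_iff_eq_mul₀ (pow_ne_zero _ hDC), eq_comm, ← mul_assoc,
    mul_inv_eq_iff_eq_mul₀ (pow_ne_zero _ hDC), hcard, mul_comm]

end OpenGraph

/-! ### The rank of the reduced density matrix -/

/-- If `P` depends on the variables with `C` or `I` only and `Q` on those with `C` or not `I`, then
summing over all variables yields a matrix which factors through the assignments of the variables
in `C`. -/
theorem rank_sum_mul_le {E ι ι' : Type*} [Fintype E] [DecidableEq E] [Fintype ι]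
    [Fintype ι'] {D : ℕ} (hD : D ≠ 0) (C I : E → Prop) (P : ι → (E → Fin D) → ℂ)
    (Q : ι' → (E → Fin D) → ℂ)
    (hP : ∀ a κ κ', (∀ e, C e ∨ I e → κ e = κ' e) → P a κ = P a κ')
    (hQ : ∀ b κ κ', (∀ e, C e ∨ ¬ I e → κ e = κ' e) → Q b κ = Q b κ') :
    (Matrix.of fun a b => ∑ κ, P a κ * Q b κ : Matrix ι ι' ℂ).rank ≤ D ^ Nat.card {e // C e} := by
  classical
  have : NeZero D := ⟨hD⟩
  let glue : ({e // C e} → Fin D) → ({e // ¬ C e ∧ I e} → Fin D) →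
      ({e // ¬ C e ∧ ¬ I e} → Fin D) → E → Fin D := fun c t s e =>
    if h : C e then c ⟨e, h⟩ else if h' : I e then t ⟨e, h, h'⟩ else s ⟨e, h, h'⟩
  let φ : (E → Fin D) ≃ ({e // C e} → Fin D) × ({e // ¬ C e ∧ I e} → Fin D) ×
      ({e // ¬ C e ∧ ¬ I e} → Fin D) :=
    { toFun := fun κ => (fun e => κ e, fun e => κ e, fun e => κ e)
      invFun := fun q => glue q.1 q.2.1 q.2.2
      left_inv := fun κ => by
        funext e
        by_cases h : C e <;> by_cases h' : I e <;> simp [glue, h, h']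
      right_inv := fun q => by
        refine Prod.ext ?_ (Prod.ext ?_ ?_) <;> funext e
        · simp [glue, e.2]
        · simp [glue, e.2.1, e.2.2]
        · simp [glue, e.2.1, e.2.2] }
  let X : Matrix ι ({e // C e} → Fin D) ℂ := Matrix.of fun a c => ∑ t, P a (glue c t 0)
  let Y : Matrix ({e // C e} → Fin D) ι' ℂ := Matrix.of fun c b => ∑ s, Q b (glue c 0 s)
  have hXY : (Matrix.of fun a b => ∑ κ, P a κ * Q b κ : Matrix ι ι' ℂ) = X * Y := by
    ext a b
    rw [Matrix.mul_apply, Matrix.of_apply, ← φ.symm.sum_comp, Fintype.sum_prod_type]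
    refine Finset.sum_congr rfl fun c _ => ?_
    simp only [X, Y, Matrix.of_apply]
    rw [Finset.sum_mul_sum, Fintype.sum_prod_type]
    refine Finset.sum_congr rfl fun t _ => Finset.sum_congr rfl fun s _ => ?_
    congr 1
    · refine hP _ _ _ fun e he => ?_
      by_cases h : C e
      · simp [φ, glue, h]
      · simp [φ, glue, h, he.resolve_left h]
    · refine hQ _ _ _ fun e he => ?_
      by_cases h : C e
      · simp [φ, glue, h]
      · simp [φ, glue, h, he.resolve_left h]
  rw [hXY]
  refine (Matrix.rank_mul_le_left X Y).trans ((Matrix.rank_le_card_width X).trans (le_of_eq ?_))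
  rw [Fintype.card_fun, Fintype.card_fin, Nat.card_eq_fintype_card]

namespace OpenGraph

variable {V Eb Eh : Type*} [Fintype V] [Fintype Eb] [DecidableEq Eb] [Fintype Eh] [DecidableEq Eh]

/-- Assemble labels of the half-edges in `A` and of the others. -/
def mergeLabels (A : Finset Eh) {D : ℕ} (a : {h // h ∈ A} → Fin D) (b : {h // h ∉ A} → Fin D) :
    Eh → Fin D :=
  fun h => if hA : h ∈ A then a ⟨h, hA⟩ else b ⟨h, hA⟩

/-- The tensor as a matrix from the half-edges outside `A` to those in `A`. -/
noncomputable def tensorMatrix (G : OpenGraph V Eb Eh) (A : Finset Eh) {D : ℕ}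
    (g : G.VertexTensors D) : Matrix ({h // h ∈ A} → Fin D) ({h // h ∉ A} → Fin D) ℂ :=
  Matrix.of fun a b => G.tensor g (mergeLabels A a b)

theorem reducedDensity_eq_mul_conjTranspose (G : OpenGraph V Eb Eh) (A : Finset Eh) {D : ℕ}
    (g : G.VertexTensors D) :
    G.reducedDensity A g = G.tensorMatrix A g * (G.tensorMatrix A g).conjTranspose := by
  ext a a'
  rw [Matrix.mul_apply]
  rfl

theorem sum_eq_sum_edgeLabels (A : Finset Eh) {D : ℕ} (F : (Eb → Fin D) → (Eh → Fin D) → ℂ)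
    (a : {h // h ∈ A} → Fin D) (b : {h // h ∉ A} → Fin D) :
    ∑ κ, F κ (mergeLabels A a b) = ∑ κ : Eb ⊕ Eh → Fin D,
      if (∀ h : {h // h ∈ A}, κ (.inr h) = a h) ∧ (∀ h : {h // h ∉ A}, κ (.inr h) = b h) then
        F (κ ∘ Sum.inl) (κ ∘ Sum.inr) else 0 := by
  rw [← (Equiv.sumArrowEquivProdArrow Eb Eh (Fin D)).symm.sum_comp, Fintype.sum_prod_type]
  refine Finset.sum_congr rfl fun κ _ => ?_
  rw [Finset.sum_eq_single (mergeLabels A a b)]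
  · rw [if_pos]
    · rfl
    · constructor
      · intro h; simp [mergeLabels, h.2]
      · intro h; simp [mergeLabels, h.2]
  · intro i _ hi
    rw [if_neg]
    rintro ⟨h1, h2⟩
    apply hi
    funext h
    by_cases hA : h ∈ A
    · simpa [mergeLabels, hA] using h1 ⟨h, hA⟩
    · simpa [mergeLabels, hA] using h2 ⟨h, hA⟩
  · simp

/-- Cutting the network along a minimal cut bounds the rank of the reduced density matrix. -/
theorem rank_reducedDensity_le (G : OpenGraph V Eb Eh) (A : Finset Eh) {D : ℕ} (hD : D ≠ 0)
    (g : G.VertexTensors D) : (G.reducedDensity A g).rank ≤ D ^ G.flow A := by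
  classical
  obtain ⟨S, hs, ht, hS⟩ := G.exists_cut A
  let amp : (V → Prop) → (Eb ⊕ Eh → Fin D) → ℂ := fun p κ =>
    ∏ x, if p x then g x (G.legLabel (κ ∘ Sum.inl) (κ ∘ Sum.inr) x) else 1
  -- a tensor at `x` only depends on the labels of the edges with end `x`
  have hamp : ∀ p κ κ', (∀ e, (∃ b x, p x ∧ (G.network A).ends e b = .vertex x) → κ e = κ' e) →
      amp p κ = amp p κ' := by
    intro p κ κ' h
    refine Finset.prod_congr rfl fun x _ => ?_
    by_cases hx : p x
    · rw [if_pos hx, if_pos hx]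
      congr 1
      funext ⟨l, hl⟩
      rcases l with ⟨e, b⟩ | i
      · exact h (.inl e) ⟨b, x, hx, by simpa [network, legVertex] using hl⟩
      · exact h (.inr i) ⟨false, x, hx, by simpa [network, legVertex] using hl⟩
    · rw [if_neg hx, if_neg hx]
  let c : ℂ := ((1 / Real.sqrt (D : ℝ) : ℝ) : ℂ) ^ Fintype.card Eb
  let P : ({h // h ∈ A} → Fin D) → (Eb ⊕ Eh → Fin D) → ℂ := fun a κ =>
    if ∀ h : {h // h ∈ A}, κ (.inr h) = a h then c * amp (fun x => .vertex x ∉ S) κ else 0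
  let Q : ({h // h ∉ A} → Fin D) → (Eb ⊕ Eh → Fin D) → ℂ := fun b κ =>
    if ∀ h : {h // h ∉ A}, κ (.inr h) = b h then amp (fun x => .vertex x ∈ S) κ else 0
  have hM : G.tensorMatrix A g = Matrix.of fun a b => ∑ κ, P a κ * Q b κ := by
    ext a b
    rw [tensorMatrix, Matrix.of_apply, Matrix.of_apply, tensor_eq_sum,
      sum_eq_sum_edgeLabels A (fun κ i => ∏ x, g x (G.legLabel κ i x)), Finset.mul_sum]
    refine Finset.sum_congr rfl fun κ _ => ?_
    simp only [P, Q, mul_ite, mul_zero, ite_mul, zero_mul]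
    rw [ite_and]
    split_ifs
    · rw [mul_assoc]
      congr 1
      simp only [amp]
      rw [← Finset.prod_mul_distrib]
      refine Finset.prod_congr rfl fun x _ => ?_
      by_cases hx : NetVertex.vertex x ∈ S <;> simp [hx]
    all_goals rfl
  have hsplit : ∀ e b, (G.network A).ends e b ∉ S →
      ¬ ((G.network A).ends e false ∈ S ↔ (G.network A).ends e true ∈ S) ∨
        (G.network A).ends e false ∉ S := by
    intro e b h
    cases b <;> tauto
  have hsplit' : ∀ e b, (G.network A).ends e b ∈ S →
      ¬ ((G.network A).ends e false ∈ S ↔ (G.network A).ends e true ∈ S) ∨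
        ¬ (G.network A).ends e false ∉ S := by
    intro e b h
    cases b <;> tauto
  have hrank := rank_sum_mul_le hD
    (fun e => ¬ ((G.network A).ends e false ∈ S ↔ (G.network A).ends e true ∈ S))
    (fun e => (G.network A).ends e false ∉ S) P Q
    (by
      intro a κ κ' h
      have h1 : ∀ i : {h // h ∈ A}, κ (.inr i) = κ' (.inr i) := fun i =>
        h _ (hsplit _ true (by simpa [network, i.2] using ht))
      have h2 := hamp (fun x => .vertex x ∉ S) κ κ' fun e ⟨b, x, hx, he⟩ =>
        h e (hsplit e b (he ▸ hx))
      simp only [P, h1, h2])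
    (by
      intro a κ κ' h
      have h1 : ∀ i : {h // h ∉ A}, κ (.inr i) = κ' (.inr i) := fun i =>
        h _ (hsplit' _ true (by simpa [network, i.2] using hs))
      have h2 := hamp (fun x => .vertex x ∈ S) κ κ' fun e ⟨b, x, hx, he⟩ =>
        h e (hsplit' e b (he ▸ hx))
      simp only [Q, h1, h2])
  rw [← hM] at hrank
  rw [reducedDensity_eq_mul_conjTranspose]
  exact (Matrix.rank_mul_le_left _ _).trans (hrank.trans (Nat.pow_le_pow_right
    (Nat.pos_of_ne_zero hD) hS))

end OpenGraph

/-! ### A moment problem -/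

/-- The linear functional on polynomials with prescribed moments. -/
noncomputable def momentFunctional (m : ℕ → ℝ) : Polynomial ℝ →ₗ[ℝ] ℝ :=
  Polynomial.lsum fun k => m k • LinearMap.id

theorem momentFunctional_apply (m : ℕ → ℝ) (p : Polynomial ℝ) :
    momentFunctional m p = p.sum fun k a => m k * a := rfl

theorem momentFunctional_C_mul_X_pow (m : ℕ → ℝ) (c : ℝ) (k : ℕ) :
    momentFunctional m (Polynomial.C c * Polynomial.X ^ k) = m k * c := by
  rw [momentFunctional_apply, Polynomial.C_mul_X_pow_eq_monomial,
    Polynomial.sum_monomial_index (f := fun k a => m k * a) c (mul_zero _)]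

/-- A functional which is nonnegative on the polynomials that are nonnegative on `[0, ∞)`, and whose
moments grow at most like `R ^ n`, is nonnegative on all polynomials that are nonnegative on a
larger interval `[0, R']`: a high power of `t / R'` makes up for negative values beyond `R'`, and
its contribution is negligible. -/
theorem momentFunctional_nonneg_of_nonneg_Icc {m : ℕ → ℝ} {R R' : ℝ} (hR : 0 ≤ R) (hRR' : R < R')
    (hm : ∀ n, m n ≤ R ^ n)
    (hpos : ∀ p : Polynomial ℝ, (∀ t, 0 ≤ t → 0 ≤ p.eval t) → 0 ≤ momentFunctional m p)
    (p : Polynomial ℝ) (hp : ∀ t ∈ Set.Icc 0 R', 0 ≤ p.eval t) : 0 ≤ momentFunctional m p := by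
  have hR' : 0 < R' := lt_of_le_of_lt hR hRR'
  set C : ℝ := p.sum fun k a => |a| * R' ^ k with hC
  have hC0 : 0 ≤ C := Finset.sum_nonneg fun k _ => by positivity
  have hlarge : ∀ N, p.natDegree ≤ N → ∀ t, R' ≤ t → |p.eval t| ≤ C * (t / R') ^ N := by
    intro N hN t ht
    rw [Polynomial.eval_eq_sum, Polynomial.sum, hC, Polynomial.sum, Finset.sum_mul]
    refine (Finset.abs_sum_le_sum_abs _ _).trans (Finset.sum_le_sum fun k hk => ?_)
    have ht0 : 0 ≤ t := hR'.le.trans ht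
    have h1 : 1 ≤ t / R' := (one_le_div hR').2 ht
    have h2 : k ≤ N := (Polynomial.le_natDegree_of_mem_supp k hk).trans hN
    calc |p.coeff k * t ^ k| = |p.coeff k| * R' ^ k * (t / R') ^ k := by
          rw [abs_mul, abs_of_nonneg (pow_nonneg ht0 k), div_pow]
          field_simp
      _ ≤ |p.coeff k| * R' ^ k * (t / R') ^ N := by gcongr
  have hbound : ∀ N, p.natDegree ≤ N → -(C * (R / R') ^ N) ≤ momentFunctional m p := by
    intro N hN
    have h1 := hpos (p + Polynomial.C (C / R' ^ N) * Polynomial.X ^ N) (by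
      intro t ht
      simp only [Polynomial.eval_add, Polynomial.eval_mul, Polynomial.eval_C, Polynomial.eval_pow,
        Polynomial.eval_X]
      rcases le_total t R' with h | h
      · have := hp t ⟨ht, h⟩
        positivity
      · have h2 := (abs_le.1 (hlarge N hN t h)).1
        have h3 : C / R' ^ N * t ^ N = C * (t / R') ^ N := by rw [div_pow]; ring
        rw [h3]
        linarith)
    rw [map_add, momentFunctional_C_mul_X_pow] at h1
    have h2 : m N * (C / R' ^ N) ≤ C * (R / R') ^ N := by
      calc m N * (C / R' ^ N) ≤ R ^ N * (C / R' ^ N) := by gcongr; exact hm N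
        _ = C * (R / R') ^ N := by rw [div_pow]; ring
    linarith
  have hlim : Tendsto (fun N : ℕ => -(C * (R / R') ^ N)) atTop (𝓝 0) := by
    have h := (tendsto_pow_atTop_nhds_zero_of_lt_one (r := R / R') (by positivity)
      ((div_lt_one hR').2 hRR')).const_mul C
    simpa using h.neg
  exact le_of_tendsto (hlim) (eventually_atTop.2 ⟨p.natDegree, hbound⟩)

/-- A positive functional on polynomials over a compact interval is represented by a measure: extend
it to the continuous functions by the M. Riesz extension theorem and use the
Riesz–Markov–Kakutani theorem. -/
theorem exists_measure_of_nonneg_Icc {m : ℕ → ℝ} {R : ℝ} (hm0 : m 0 = 1)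
    (hpos : ∀ p : Polynomial ℝ, (∀ t ∈ Set.Icc 0 R, 0 ≤ p.eval t) → 0 ≤ momentFunctional m p) :
    ∃ ν : Measure (Set.Icc 0 R), IsProbabilityMeasure ν ∧ ∀ n, ∫ t, (t : ℝ) ^ n ∂ν = m n := by
  let X := Set.Icc (0 : ℝ) R
  let res : Polynomial ℝ →ₗ[ℝ] C(X, ℝ) := (Polynomial.toContinuousMapOnAlgHom X).toLinearMap
  have hres : ∀ p (t : X), res p t = p.eval (t : ℝ) := fun _ _ => rfl
  have hker : LinearMap.ker res ≤ LinearMap.ker (momentFunctional m) := by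
    intro p hp
    have h0 : ∀ t ∈ X, p.eval t = 0 :=
      fun t ht => DFunLike.congr_fun (LinearMap.mem_ker.1 hp) ⟨t, ht⟩
    have h1 := hpos p fun t ht => (h0 t ht).ge
    have h2 := hpos (-p) fun t ht => by simp [h0 t ht]
    rw [map_neg] at h2
    exact LinearMap.mem_ker.2 (by linarith)
  let f : C(X, ℝ) →ₗ.[ℝ] ℝ := ⟨LinearMap.range res,
    ((LinearMap.ker res).liftQ (momentFunctional m) hker).comp
      res.quotKerEquivRange.symm.toLinearMap⟩
  have hf : ∀ (p : Polynomial ℝ) (h : res p ∈ LinearMap.range res),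
      f ⟨res p, h⟩ = momentFunctional m p := by
    intro p h
    change (LinearMap.ker res).liftQ (momentFunctional m) hker
      (res.quotKerEquivRange.symm ⟨res p, h⟩) = _
    rw [LinearMap.quotKerEquivRange_symm_apply_image]
    rfl
  obtain ⟨g, hgf, hg⟩ := riesz_extension (PointedCone.positive ℝ C(X, ℝ)) f
    (by
      rintro ⟨_, p, rfl⟩ hp
      exact (hpos p fun t ht => (ContinuousMap.le_def.1 hp) ⟨t, ht⟩).trans_eq (hf p _).symm)
    (by
      intro y
      refine ⟨⟨res (Polynomial.C ‖y‖), LinearMap.mem_range_self _ _⟩, ?_⟩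
      change (0 : C(X, ℝ)) ≤ res (Polynomial.C ‖y‖) + y
      rw [ContinuousMap.le_def]
      intro t
      have h := (abs_le.1 (y.norm_coe_le_norm t)).1
      rw [ContinuousMap.add_apply, hres, Polynomial.eval_C, ContinuousMap.zero_apply]
      linarith)
  let L : CompactlySupportedContinuousMap X ℝ →ₗ[ℝ] ℝ :=
    { toFun := fun φ => g φ.toContinuousMap
      map_add' := fun φ ψ => g.map_add φ.toContinuousMap ψ.toContinuousMap
      map_smul' := fun c φ => g.map_smul c φ.toContinuousMap }
  let Λ : CompactlySupportedContinuousMap X ℝ →ₚ[ℝ] ℝ := PositiveLinearMap.mk₀ L fun φ hφ => hg _ hφ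
  let ν := RealRMK.rieszMeasure Λ
  have hν : ∀ n, ∫ t : X, (t : ℝ) ^ n ∂ν = m n := by
    intro n
    let φ : CompactlySupportedContinuousMap X ℝ :=
      ⟨res (Polynomial.X ^ n), HasCompactSupport.of_compactSpace _⟩
    have h1 : ∫ t, φ t ∂ν = g (res (Polynomial.X ^ n)) := RealRMK.integral_rieszMeasure Λ φ
    have h2 : g (res (Polynomial.X ^ n)) = m n := by
      have h3 := hgf ⟨res (Polynomial.X ^ n), LinearMap.mem_range_self _ _⟩
      have h4 := momentFunctional_C_mul_X_pow m 1 n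
      rw [Polynomial.C_1, one_mul, mul_one] at h4
      exact h3.trans ((hf _ _).trans h4)
    rw [← h2, ← h1]
    congr 1
    funext t
    change _ = res (Polynomial.X ^ n) t
    rw [hres, Polynomial.eval_pow, Polynomial.eval_X]
  refine ⟨ν, ⟨?_⟩, hν⟩
  have h0 := hν 0
  simp only [pow_zero, integral_const, smul_eq_mul, mul_one, hm0] at h0
  rw [measureReal_def] at h0
  rw [← ENNReal.toReal_eq_one_iff]
  exact h0

/-- Moments of exponential growth which are limits of moments on `[0, ∞)` belong to a compactly
supported probability measure on `[0, ∞)`. -/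
theorem exists_measure_of_moments {m : ℕ → ℝ} {R : ℝ} (hR : 0 ≤ R) (hm0 : m 0 = 1)
    (hm : ∀ n, m n ≤ R ^ n)
    (hpos : ∀ p : Polynomial ℝ, (∀ t, 0 ≤ t → 0 ≤ p.eval t) → 0 ≤ momentFunctional m p) :
    ∃ μ : Measure ℝ, IsProbabilityMeasure μ ∧ IsCompact μ.support ∧ μ.support ⊆ Set.Ici 0 ∧
      ∀ n : ℕ, Integrable (fun t : ℝ => t ^ n) μ ∧ ∫ t, t ^ n ∂μ = m n := by
  obtain ⟨ν, hν, hνm⟩ := exists_measure_of_nonneg_Icc hm0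
    (momentFunctional_nonneg_of_nonneg_Icc hR (lt_add_one R) hm hpos)
  have hemb : MeasurableEmbedding (Subtype.val : Set.Icc (0 : ℝ) (R + 1) → ℝ) :=
    MeasurableEmbedding.subtype_coe measurableSet_Icc
  have hsupp : (ν.map Subtype.val).support ⊆ Set.Icc 0 (R + 1) := by
    apply Measure.support_subset_of_isClosed isClosed_Icc
    rw [mem_ae_iff, hemb.map_apply]
    convert measure_empty (μ := ν)
    ext t
    simp
  refine ⟨ν.map Subtype.val, Measure.isProbabilityMeasure_map hemb.measurable.aemeasurable,
    isCompact_Icc.of_isClosed_subset Measure.isClosed_support hsupp,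
    hsupp.trans fun t ht => ht.1, fun n => ⟨?_, ?_⟩⟩
  · rw [hemb.integrable_map_iff]
    have hcont : Continuous fun t : Set.Icc (0 : ℝ) (R + 1) => (t : ℝ) ^ n := by fun_prop
    exact hcont.integrable_of_hasCompactSupport (HasCompactSupport.of_compactSpace _)
  · rw [hemb.integral_map, hνm]

open scoped ComplexOrder

/-! ### Moments of positive semidefinite matrices of bounded rank -/

theorem trace_pow_eq_sum_eigenvalues {ι : Type*} [Fintype ι] [DecidableEq ι] {M : Matrix ι ι ℂ}
    (hM : M.IsHermitian) (n : ℕ) : (M ^ n).trace = ∑ i, (hM.eigenvalues i : ℂ) ^ n := by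
  conv_lhs => rw [hM.spectral_theorem]
  rw [← map_pow, Matrix.diagonal_pow, Unitary.conjStarAlgAut_apply, Matrix.trace_mul_comm,
    ← mul_assoc, Unitary.coe_star_mul_self, one_mul, Matrix.trace_diagonal]
  rfl

/-- The moments of a positive semidefinite matrix of rank at most `r`, divided by `r`, are the
moments of a probability measure if the moment of order zero is replaced by one: this amounts to
keeping only `r` eigenvalues, the nonzero ones among them. -/
theorem momentFunctional_nonneg_of_posSemidef {ι : Type*} [Fintype ι] [DecidableEq ι]
    {M : Matrix ι ι ℂ} (hM : M.PosSemidef) {r : ℕ} (hr0 : r ≠ 0) (hr : M.rank ≤ r) {s : ℝ}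
    (hs : 0 ≤ s) {m : ℕ → ℝ} (hm0 : m 0 = 1)
    (hm : ∀ n, n ≠ 0 → r * m n = s ^ n * ((M ^ n).trace).re) {p : Polynomial ℝ}
    (hp : ∀ t, 0 ≤ t → 0 ≤ p.eval t) : 0 ≤ momentFunctional m p := by
  classical
  let ev := hM.1.eigenvalues
  let nz : Finset ι := Finset.univ.filter fun i => ev i ≠ 0
  have hcard : (nz.card : ℝ) ≤ r := by
    have h := hM.1.rank_eq_card_non_zero_eigs
    rw [Fintype.card_subtype] at h
    exact_mod_cast h ▸ hr
  have hmom : ∀ n, r * m n = ∑ i ∈ nz, (s * ev i) ^ n + (r - nz.card) * 0 ^ n := by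
    intro n
    by_cases hn : n = 0
    · subst hn
      simp [hm0]
    · have hnz : ∑ i ∈ nz, (s * ev i) ^ n = ∑ i, (s * ev i) ^ n :=
        Finset.sum_filter_of_ne fun i _ h h0 => h (by simp [h0, hn])
      rw [hm n hn, trace_pow_eq_sum_eigenvalues hM.1, zero_pow hn, mul_zero, add_zero, hnz,
        Complex.re_sum, Finset.mul_sum]
      refine Finset.sum_congr rfl fun i _ => ?_
      rw [mul_pow]
      congr 1
      rw [← Complex.ofReal_pow, Complex.ofReal_re]
  have hL : r * momentFunctional m p =
      ∑ i ∈ nz, p.eval (s * ev i) + (r - nz.card) * p.eval 0 := by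
    simp only [momentFunctional_apply, Polynomial.sum, Polynomial.eval_eq_sum]
    rw [Finset.sum_comm, Finset.mul_sum, Finset.mul_sum, ← Finset.sum_add_distrib]
    refine Finset.sum_congr rfl fun k _ => ?_
    rw [← mul_assoc, hmom, ← Finset.mul_sum]
    ring
  have hnonneg : 0 ≤ r * momentFunctional m p := by
    rw [hL]
    refine add_nonneg (Finset.sum_nonneg fun i _ => hp _ (mul_nonneg hs (hM.eigenvalues_nonneg i)))
      (mul_nonneg (by linarith) (hp 0 le_rfl))
  exact nonneg_of_mul_nonneg_right hnonneg (by positivity)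

/-! ### The limit of large bond dimension -/

namespace OpenGraph

variable {V Eb Eh : Type*} [Fintype V] [Fintype Eb] [DecidableEq Eb] [Fintype Eh] [DecidableEq Eh]

theorem scaledTrace_eq (G : OpenGraph V Eb Eh) (A : Finset Eh) (n D : ℕ) (g : G.VertexTensors D) :
    G.scaledTrace A n D g = 1 / (D : ℂ) ^ G.flow A *
      (((D : ℂ) ^ ((G.flow A : ℤ) - (Fintype.card Eh : ℤ))) ^ n *
        ((G.reducedDensity A g) ^ n).trace) := by
  rw [scaledTrace, smul_pow, Matrix.trace_smul, smul_eq_mul]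

/-- The moments of the rescaled reduced density matrix, with the moment of order zero replaced by
one. -/
noncomputable def sampleMoment (G : OpenGraph V Eb Eh) (A : Finset Eh) (D : ℕ)
    (g : G.VertexTensors D) (n : ℕ) : ℝ :=
  if n = 0 then 1 else (G.scaledTrace A n D g).re

theorem momentFunctional_sampleMoment_nonneg (G : OpenGraph V Eb Eh) (A : Finset Eh) {D : ℕ}
    (hD : D ≠ 0) (g : G.VertexTensors D) {p : Polynomial ℝ} (hp : ∀ t, 0 ≤ t → 0 ≤ p.eval t) :
    0 ≤ momentFunctional (G.sampleMoment A D g) p := by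
  have hM : (G.reducedDensity A g).PosSemidef := by
    rw [reducedDensity_eq_mul_conjTranspose]
    exact Matrix.posSemidef_self_mul_conjTranspose _
  have hDR : (D : ℝ) ≠ 0 := by exact_mod_cast hD
  refine momentFunctional_nonneg_of_posSemidef hM (pow_ne_zero (G.flow A) hD)
    (G.rank_reducedDensity_le A hD g)
    (s := (D : ℝ) ^ ((G.flow A : ℤ) - (Fintype.card Eh : ℤ))) (by positivity)
    (if_pos rfl) (fun n hn => ?_) hp
  have h : G.scaledTrace A n D g = (((1 / (D : ℝ) ^ G.flow A *
      ((D : ℝ) ^ ((G.flow A : ℤ) - (Fintype.card Eh : ℤ))) ^ n : ℝ)) : ℂ) *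
        ((G.reducedDensity A g) ^ n).trace := by
    rw [scaledTrace_eq]
    push_cast
    ring
  rw [sampleMoment, if_neg hn, h, Complex.re_ofReal_mul]
  push_cast
  field_simp

variable [DecidableEq V]

theorem integrable_scaledTrace (G : OpenGraph V Eb Eh) (A : Finset Eh) {n : ℕ} (hn : 1 ≤ n)
    (D : ℕ) : Integrable (G.scaledTrace A n D) (G.gaussianLaw D) := by
  simp only [funext fun g => G.scaledTrace_eq A n D g]
  exact ((G.integrable_trace_reducedDensity_pow A hn).const_mul _).const_mul _

/-- After rescaling, a configuration contributes according to its energy above the ground state. -/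
theorem integral_scaledTrace (G : OpenGraph V Eb Eh) (A : Finset Eh) {n D : ℕ} (hn : 1 ≤ n)
    (hD : D ≠ 0) : ∫ g, G.scaledTrace A n D g ∂(G.gaussianLaw D) =
      ∑ α : V → Equiv.Perm (Fin n),
        ((D : ℂ) ^ (G.hamiltonian A n α - G.flow A * (n - 1)))⁻¹ := by
  have hDC : (D : ℂ) ≠ 0 := by exact_mod_cast hD
  simp only [G.scaledTrace_eq A n D]
  rw [integral_const_mul, integral_const_mul, G.integral_trace_reducedDensity_pow A hn hD,
    Finset.mul_sum, Finset.mul_sum]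
  refine Finset.sum_congr rfl fun α _ => ?_
  have hle := G.flow_mul_le_hamiltonian A hn α
  rw [one_div]
  simp only [← zpow_natCast, ← zpow_neg, ← zpow_mul, ← zpow_add₀ hDC]
  congr 1
  rw [Nat.cast_sub hle]
  push_cast [Nat.cast_sub hn]
  ring

theorem tendsto_integral_scaledTrace (G : OpenGraph V Eb Eh) (A : Finset Eh) {n : ℕ} (hn : 1 ≤ n) :
    Tendsto (fun D : ℕ => ∫ g, G.scaledTrace A n D g ∂(G.gaussianLaw D)) atTop
      (𝓝 (G.numMinimizers A n : ℂ)) := by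
  classical
  have hnum : (G.numMinimizers A n : ℂ) = ∑ α : V → Equiv.Perm (Fin n),
      if G.hamiltonian A n α = G.flow A * (n - 1) then 1 else 0 := by
    rw [numMinimizers, Nat.card_congr (Equiv.subtypeEquivRight fun α => G.isMinimizer_iff A hn α),
      Nat.card_eq_fintype_card, Fintype.card_subtype, Finset.sum_boole]
  rw [hnum]
  have hsum : Tendsto (fun D : ℕ => ∑ α : V → Equiv.Perm (Fin n),
      ((D : ℂ) ^ (G.hamiltonian A n α - G.flow A * (n - 1)))⁻¹) atTop
      (𝓝 (∑ α : V → Equiv.Perm (Fin n),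
        if G.hamiltonian A n α = G.flow A * (n - 1) then 1 else 0)) := by
    refine tendsto_finsetSum _ fun α _ => ?_
    have hle := G.flow_mul_le_hamiltonian A hn α
    split_ifs with h
    · simp [h]
    · have hpos : G.hamiltonian A n α - G.flow A * (n - 1) ≠ 0 := by omega
      have h1 := (tendsto_inv_atTop_nhds_zero_nat (𝕜 := ℂ)).pow
        (G.hamiltonian A n α - G.flow A * (n - 1))
      rw [zero_pow hpos] at h1
      simpa only [inv_pow] using h1
  refine hsum.congr' ?_
  filter_upwards [eventually_ne_atTop 0] with D hD
  exact (G.integral_scaledTrace A hn hD).symm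

/-- The numbers of ground states, supplemented by one at `n = 0`. -/
noncomputable def limitMoment (G : OpenGraph V Eb Eh) (A : Finset Eh) (n : ℕ) : ℝ :=
  if n = 0 then 1 else G.numMinimizers A n

theorem momentFunctional_limitMoment_nonneg (G : OpenGraph V Eb Eh) (A : Finset Eh)
    {p : Polynomial ℝ} (hp : ∀ t, 0 ≤ t → 0 ≤ p.eval t) :
    0 ≤ momentFunctional (G.limitMoment A) p := by
  have hint : ∀ n D, Integrable (fun g => G.sampleMoment A D g n) (G.gaussianLaw D) := by
    intro n D
    by_cases hn : n = 0
    · simp [sampleMoment, hn]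
    · simp only [sampleMoment, hn, if_false]
      exact (G.integrable_scaledTrace A (Nat.one_le_iff_ne_zero.2 hn) D).re
  have hlim : ∀ n, Tendsto (fun D : ℕ => ∫ g, G.sampleMoment A D g n ∂(G.gaussianLaw D)) atTop
      (𝓝 (G.limitMoment A n)) := by
    intro n
    by_cases hn : n = 0
    · simp [sampleMoment, limitMoment, hn]
    · have hn' := Nat.one_le_iff_ne_zero.2 hn
      have h1 := (Complex.continuous_re.tendsto _).comp (G.tendsto_integral_scaledTrace A hn')
      rw [Complex.natCast_re] at h1
      simp only [sampleMoment, limitMoment, hn, if_false]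
      refine h1.congr fun D => ?_
      exact (integral_re (G.integrable_scaledTrace A hn' D)).symm
  have htend : Tendsto (fun D : ℕ => ∫ g, momentFunctional (G.sampleMoment A D g) p
      ∂(G.gaussianLaw D)) atTop (𝓝 (momentFunctional (G.limitMoment A) p)) := by
    simp only [momentFunctional_apply, Polynomial.sum]
    have h1 : ∀ D, ∫ g, ∑ k ∈ p.support, G.sampleMoment A D g k * p.coeff k ∂(G.gaussianLaw D) =
        ∑ k ∈ p.support, (∫ g, G.sampleMoment A D g k ∂(G.gaussianLaw D)) * p.coeff k := by
      intro D
      rw [integral_finsetSum _ fun k _ => (hint k D).mul_const _]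
      simp only [integral_mul_const]
    simp only [h1]
    exact tendsto_finsetSum _ fun k _ => (hlim k).mul_const _
  refine ge_of_tendsto htend ?_
  filter_upwards [eventually_ne_atTop 0] with D hD
  exact integral_nonneg fun g => G.momentFunctional_sampleMoment_nonneg A hD g hp

end OpenGraph

end RTN

theorem theorem5p10 {V Eb Eh : Type*} [Fintype V] [DecidableEq V] [Fintype Eb] [DecidableEq Eb]
    [Fintype Eh] [DecidableEq Eh] (G : RTN.OpenGraph V Eb Eh) (hG : G.bulk.Connected)
    (hEh : Nonempty Eh) (A : Finset Eh) :
    (∀ n : ℕ, 1 ≤ n →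
      (∀ D : ℕ, Integrable (G.scaledTrace A n D) (G.gaussianLaw D)) ∧
      Tendsto (fun D : ℕ => ∫ g, G.scaledTrace A n D g ∂(G.gaussianLaw D)) atTop
        (𝓝 (G.numMinimizers A n : ℂ))) ∧
    ∃ μ : Measure ℝ, IsProbabilityMeasure μ ∧ IsCompact μ.support ∧ μ.support ⊆ Set.Ici 0 ∧
      ∀ n : ℕ, 1 ≤ n →
        Integrable (fun t : ℝ => t ^ n) μ ∧ ∫ t, t ^ n ∂μ = (G.numMinimizers A n : ℝ) := by
  refine ⟨fun n hn => ⟨fun D => G.integrable_scaledTrace A hn D,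
    G.tendsto_integral_scaledTrace A hn⟩, ?_⟩
  obtain ⟨μ, hμ, hc, hs, hm⟩ := RTN.exists_measure_of_moments (m := G.limitMoment A)
    (R := 4 ^ Fintype.card V) (by positivity) (if_pos rfl)
    (fun n => by
      by_cases hn : n = 0
      · simp [RTN.OpenGraph.limitMoment, hn]
      · rw [RTN.OpenGraph.limitMoment, if_neg hn]
        exact_mod_cast G.numMinimizers_le hG hEh A (Nat.one_le_iff_ne_zero.2 hn))
    (fun p hp => G.momentFunctional_limitMoment_nonneg A hp)
  refine ⟨μ, hμ, hc, hs, fun n hn => ⟨(hm n).1, ?_⟩⟩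
  rw [(hm n).2, RTN.OpenGraph.limitMoment, if_neg (Nat.one_le_iff_ne_zero.1 hn)]
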